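/- Let $\Omega\subset\mathbb R^2$ be a bounded, connected, simply connected domain whose boundary is a piecewise smooth simple closed curve (the pieces being at least $C^1$ up to their endpoints), of length $|\partial\Omega|$. Choose a reference point on $\partial\Omega$ and let $\gamma:\mathbb R/|\partial\Omega|\mathbb Z\to\partial\Omega$ be the positively oriented arclength parametrization starting there. Let $\Phi=\{(s,\theta): 0\le s<|\partial\Omega|,\ 0\le\theta\le\pi\}$ be the billiard phase space, where $s$ is the arclength coordinate of the footpoint and $\theta$ is the angle between the positive tangent at $\gamma(s)$ and the inward direction of motion. Equip $\Phi$ with the Liouville measure $d\nu=\sin\theta\,ds\,d\theta$, so that $\nu(\Phi)=2|\partial\Omega|$. The billiard map $\varphi$ sends $(s,\theta)$ to $(s',\theta')$, where $\gamma(s')$ is the point at which the ray from $\gamma(s)$ in direction $\theta$ first hits $\partial\Omega$, and $\theta'$ is the direction after reflection in the tangent line at $\gamma(s')$. It is regarded as defined at $(s,\theta)$ if $\partial\Omega$ has a tangent at $\gamma(s)$ and at $\gamma(s')$, $0<\theta<\pi$, and the hit is transversal. For such $z=(s,\theta)$ with $\varphi(z)=(s',\theta')$ let $\xi(z)\in[0,|\partial\Omega|)$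 be the unique number with $s+\xi(z)=s'$ or $s+\xi(z)=s'+|\partial\Omega|$ (the footpoint increment). The footpoint gain of $z$ is $$\upsilon(z)=\lim_{n\to\infty}\frac1n\sum_{k=0}^{n-1}\xi(\varphi^k(z)),$$ when all $\varphi^k(z)$, $k\ge 0$, are defined and the limit exists, and the rotation number of $z$ is $\rho(z)=\upsilon(z)/|\partial\Omega|$. 1. The footpoint gain $\upsilon(z)$ exists for $\nu$-almost every $z\in\Phi$. The function $\upsilon$ is measurable (it has a measurable domain, and its extension by $0$ is measurable), it is invariant under $\varphi$ (if $\varphi(z)$ is defined, then $\upsilon(\varphi(z))$ exists if and only if $\upsilon(z)$ does, and then they are equal), and $0\le\upsilon\le|\partial\Omega|$ wherever it exists. It is integrable, and $$0\le\frac{\int_\Phi\upsilon\,d\nu}{\nu(\Phi)}\le|\partial\Omega|.$$ 2. Equivalently, the rotation number $\rho(z)$ exists for $\nu$-almost every $z\in\Phi$. The function $\rho$ is measurable and invariant under $\varphi$ in the same sense, it satisfies $0\le\rho\le1$ wherever it exists, it is integrable, and $$0\le\frac{\int_\Phi\rho\,d\nu}{\nu(\Phi)}\le1.$$ -/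

import Mathlib

open Set Filter Topology MeasureTheory

noncomputable section

namespace Billiard

/-- The Euclidean plane is identified with `ℂ`. `γ` is a positively oriented arclength
parametrization, with period `L`, of the boundary of `Ω`, and this boundary is a piecewise smooth
simple closed curve. Smoothness of the pieces is only required to be `C¹` up to their endpoints;
corners and cusps are allowed. `L` is the perimeter `|∂Ω|`. -/
structure IsArclengthBoundary (Ω : Set ℂ) (L : ℝ) (γ : ℝ → ℂ) : Prop where
  pos : 0 < L
  continuous : Continuous γ
  periodic : Function.Periodic γ L
  injOn : InjOn γ (Ico 0 L)
  range_eq : range γ = frontier Ω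
  piecewise : ∃ (n : ℕ) (a : ℕ → ℝ), a 0 = 0 ∧ a n = L ∧ ∀ i < n, a i < a (i + 1) ∧
    ContDiffOn ℝ 1 γ (Icc (a i) (a (i + 1))) ∧
    ∀ s ∈ Icc (a i) (a (i + 1)), ‖derivWithin γ (Icc (a i) (a (i + 1))) s‖ = 1
  /-- Positive orientation: `Ω` lies on the left of `γ`, and not on the right of it, at every
  point that has a tangent. -/
  oriented : ∀ s, DifferentiableAt ℝ γ s → ∀ᶠ ε : ℝ in 𝓝[>] 0,
    γ s + (ε : ℂ) * (Complex.I * deriv γ s) ∈ Ω ∧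
    γ s - (ε : ℂ) * (Complex.I * deriv γ s) ∉ closure Ω

/-- A bounded, connected, simply connected planar domain `Ω` with piecewise smooth boundary,
together with a choice of positively oriented arclength parametrization of the boundary
(equivalently, a choice of the reference point `γ 0`). -/
structure IsTable (Ω : Set ℂ) (L : ℝ) (γ : ℝ → ℂ) : Prop where
  isOpen : IsOpen Ω
  isBounded : Bornology.IsBounded Ω
  isConnected : IsConnected Ω
  simplyConnected : SimplyConnectedSpace Ω
  boundary : IsArclengthBoundary Ω L γ

/-- The phase space in the coordinates `(s, θ)`. The circle `ℝ / Lℤ` is represented by `[0, L)`. -/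
def phaseSpace (L : ℝ) : Set (ℝ × ℝ) := Ico 0 L ×ˢ Icc 0 Real.pi

/-- The Liouville measure `sin θ ds dθ` on the phase space. -/
def liouville (L : ℝ) : Measure (ℝ × ℝ) :=
  (volume.restrict (phaseSpace L)).withDensity (fun z => ENNReal.ofReal (Real.sin z.2))

/-- The direction of the velocity at the phase point `(s, θ)`: it makes the angle `θ` with the
positively oriented tangent at the footpoint `γ s`. -/
def direction (γ : ℝ → ℂ) (z : ℝ × ℝ) : ℂ :=
  deriv γ z.1 * Complex.exp ((z.2 : ℂ) * Complex.I)

/-- The reflection of `v` in the real line spanned by the unit vector `τ`. -/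
def reflect (τ v : ℂ) : ℂ := τ ^ 2 * (starRingEnd ℂ) v

/-- The billiard ball that leaves `γ s` in the direction `θ` moves inside `Ω` along a straight
segment until it hits the boundary, at the point `γ s'`, where it is reflected in the tangent line
(angle of incidence equals angle of reflection) to the direction `θ'`. Both footpoints have a
tangent, and the ball leaves and arrives transversally. -/
structure IsStep (Ω : Set ℂ) (L : ℝ) (γ : ℝ → ℂ) (z z' : ℝ × ℝ) : Prop where
  left_s : z.1 ∈ Ico 0 L
  left_θ : z.2 ∈ Ioo 0 Real.pi
  left_diff : DifferentiableAt ℝ γ z.1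
  right_s : z'.1 ∈ Ico 0 L
  right_θ : z'.2 ∈ Ioo 0 Real.pi
  right_diff : DifferentiableAt ℝ γ z'.1
  flight : ∃ t : ℝ, 0 < t ∧ γ z'.1 = γ z.1 + (t : ℂ) * direction γ z ∧
    ∀ r ∈ Ioo 0 t, γ z.1 + (r : ℂ) * direction γ z ∈ Ω
  reflection : direction γ z' = reflect (deriv γ z'.1) (direction γ z)

/-- The set of phase points at which the billiard map is defined. -/
def regularSet (Ω : Set ℂ) (L : ℝ) (γ : ℝ → ℂ) : Set (ℝ × ℝ) :=
  {z | ∃ z', IsStep Ω L γ z z'}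

open Classical in
/-- The billiard map `φ` (the dummy value outside of `regularSet` is never used: orbits that leave
`regularSet` have no footpoint gain). -/
def billiardMap (Ω : Set ℂ) (L : ℝ) (γ : ℝ → ℂ) (z : ℝ × ℝ) : ℝ × ℝ :=
  if h : ∃ z', IsStep Ω L γ z z' then h.choose else z

/-- The number `0 ≤ ξ < L` such that `s₁ + ξ = s₂` or `s₁ + ξ = s₂ + L`, for `s₁, s₂ ∈ [0, L)`. -/
def arcIncrement (L s₁ s₂ : ℝ) : ℝ := if s₁ ≤ s₂ then s₂ - s₁ else s₂ + L - s₁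

/-- The footpoint increment function `ξ` on the phase space. -/
def footpointIncrement (Ω : Set ℂ) (L : ℝ) (γ : ℝ → ℂ) (z : ℝ × ℝ) : ℝ :=
  arcIncrement L z.1 (billiardMap Ω L γ z).1

/-- The whole forward orbit of `z` is defined, and `υ(z)` exists and is equal to `u`. -/
def HasFootpointGain (Ω : Set ℂ) (L : ℝ) (γ : ℝ → ℂ) (z : ℝ × ℝ) (u : ℝ) : Prop :=
  (∀ k : ℕ, (billiardMap Ω L γ)^[k] z ∈ regularSet Ω L γ) ∧
  Tendsto (fun n : ℕ => (1 / (n : ℝ)) *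
    ∑ k ∈ Finset.range n, footpointIncrement Ω L γ ((billiardMap Ω L γ)^[k] z)) atTop (𝓝 u)

open Classical in
/-- The footpoint gain `υ`, extended by `0` to the points where it does not exist. -/
def footpointGain (Ω : Set ℂ) (L : ℝ) (γ : ℝ → ℂ) (z : ℝ × ℝ) : ℝ :=
  if h : ∃ u, HasFootpointGain Ω L γ z u then h.choose else 0

/-- The rotation number `ρ(z) = υ(z) / |∂Ω|` exists and is equal to `r`. -/
def HasRotationNumber (Ω : Set ℂ) (L : ℝ) (γ : ℝ → ℂ) (z : ℝ × ℝ) (r : ℝ) : Prop :=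
  ∃ u, HasFootpointGain Ω L γ z u ∧ r = u / L

/-- The rotation number function `ρ = υ / |∂Ω|`. -/
def rotationNumber (Ω : Set ℂ) (L : ℝ) (γ : ℝ → ℂ) (z : ℝ × ℝ) : ℝ :=
  footpointGain Ω L γ z / L

theorem HasFootpointGain.eq_footpointGain {Ω : Set ℂ} {L : ℝ} {γ : ℝ → ℂ} {z : ℝ × ℝ} {u : ℝ}
    (h : HasFootpointGain Ω L γ z u) : footpointGain Ω L γ z = u := by
  have hex : ∃ u, HasFootpointGain Ω L γ z u := ⟨u, h⟩
  rw [footpointGain, dif_pos hex]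
  exact tendsto_nhds_unique hex.choose_spec.2 h.2

theorem IsArclengthBoundary.norm_deriv {Ω : Set ℂ} {L : ℝ} {γ : ℝ → ℂ}
    (hb : IsArclengthBoundary Ω L γ) {s : ℝ} (hs : s ∈ Ico 0 L)
    (hd : DifferentiableAt ℝ γ s) : ‖deriv γ s‖ = 1 := by
  obtain ⟨n, a, h0, hn, ha⟩ := hb.piecewise
  have key : ∀ m ≤ n, s < a m → ∃ i < n, s ∈ Icc (a i) (a (i + 1)) := by
    intro m
    induction m with
    | zero => intro _ h; rw [h0] at h; exact absurd hs.1 (not_le.2 h)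
    | succ m ih =>
      intro hm h
      by_cases hc : s < a m
      · exact ih (by omega) hc
      · exact ⟨m, by omega, not_lt.1 hc, h.le⟩
  obtain ⟨i, hi, hsi⟩ := key n le_rfl (by rw [hn]; exact hs.2)
  obtain ⟨hlt, -, hu⟩ := ha i hi
  rw [← hd.derivWithin (uniqueDiffOn_Icc hlt s hsi)]
  exact hu s hsi

/-- The billiard map is well defined: the next phase point is unique. -/
theorem IsStep.unique {Ω : Set ℂ} {L : ℝ} {γ : ℝ → ℂ} (hT : IsTable Ω L γ) {z z₁ z₂ : ℝ × ℝ}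
    (h₁ : IsStep Ω L γ z z₁) (h₂ : IsStep Ω L γ z z₂) : z₁ = z₂ := by
  have hmem : ∀ s, γ s ∉ Ω := by
    intro s hs
    have hf : γ s ∈ frontier Ω := hT.boundary.range_eq ▸ mem_range_self s
    rw [hT.isOpen.frontier_eq] at hf
    exact hf.2 hs
  obtain ⟨t₁, p₁, e₁, i₁⟩ := h₁.flight
  obtain ⟨t₂, p₂, e₂, i₂⟩ := h₂.flight
  have ht : t₁ = t₂ := by
    rcases lt_trichotomy t₁ t₂ with h | h | h
    · exact absurd (e₁ ▸ i₂ t₁ ⟨p₁, h⟩) (hmem _)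
    · exact h
    · exact absurd (e₂ ▸ i₁ t₂ ⟨p₂, h⟩) (hmem _)
  have hs : z₁.1 = z₂.1 :=
    hT.boundary.injOn h₁.right_s h₂.right_s (by rw [e₁, e₂, ht])
  have hne : deriv γ z₂.1 ≠ 0 := by
    rw [← norm_ne_zero_iff, hT.boundary.norm_deriv h₂.right_s h₂.right_diff]
    exact one_ne_zero
  have hd : direction γ z₁ = direction γ z₂ := by
    rw [h₁.reflection, h₂.reflection, hs]
  unfold direction at hd
  rw [hs] at hd
  have he := mul_left_cancel₀ hne hd
  have hc : Real.cos z₁.2 = Real.cos z₂.2 := by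
    have := congrArg Complex.re he
    simpa [Complex.exp_ofReal_mul_I_re] using this
  exact Prod.ext hs (Real.injOn_cos ⟨h₁.right_θ.1.le, h₁.right_θ.2.le⟩
    ⟨h₂.right_θ.1.le, h₂.right_θ.2.le⟩ hc)

theorem billiardMap_eq {Ω : Set ℂ} {L : ℝ} {γ : ℝ → ℂ} (hT : IsTable Ω L γ) {z z' : ℝ × ℝ}
    (h : IsStep Ω L γ z z') : billiardMap Ω L γ z = z' := by
  have hex : ∃ z', IsStep Ω L γ z z' := ⟨z', h⟩
  rw [billiardMap, dif_pos hex]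
  exact IsStep.unique hT hex.choose_spec h

end Billiard

end

/-! The billiard map preserves the finite measure ν and is defined ν-almost everywhere, so
Birkhoff's theorem for the bounded function ξ gives the footpoint gain almost everywhere. Invariance
comes from telescoping, and the bounds from 0 ≤ ξ ≤ L.

Invariance of ν cannot be read off a Jacobian of the map, since γ is only piecewise C¹. Instead, a
regular phase point is encoded by the pair (s, s') of its two footpoints. For fixed s the angle θ is
differentiable in s', and slicing over s turns ν into K(s, s') ds ds' with K symmetric
(`liouville_image_chordPhase`, `chordKernel_swap`). In these coordinates the map is the swap (s, s')
↦ (s', s) followed by θ ↦ π - θ, and both preserve ν (`measurePreserving_billiardMap`).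

For almost everywhere definedness, fix s with a tangent. An inward ray first hits the boundary at
some s'. It fails to be regular only if s' is one of finitely many corners, or if the arrival is
tangential, which makes θ a critical value of s' ↦ θ. Sard's theorem in dimension one shows that
such θ form a null set, and Fubini finishes (`volume_slice_compl_regularSet`,
`liouville_compl_regularSet`). -/

noncomputable section

namespace Billiard

open ComplexConjugate

/-! ### Birkhoff's ergodic theorem for bounded functions -/

section Birkhoff

variable {X : Type*} {T : X → X} {g : X → ℝ}

/-- The maximum of `0` and of the first `N` Birkhoff sums of `g`. -/
def maxBirkhoffSum (T : X → X) (g : X → ℝ) : ℕ → X → ℝ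
  | 0 => fun _ => 0
  | N + 1 => fun x => max 0 (g x + maxBirkhoffSum T g N (T x))

theorem maxBirkhoffSum_nonneg (N : ℕ) (x : X) : 0 ≤ maxBirkhoffSum T g N x := by
  cases N with
  | zero => exact le_rfl
  | succ N => exact le_max_left _ _

theorem maxBirkhoffSum_le_succ (N : ℕ) (x : X) :
    maxBirkhoffSum T g N x ≤ maxBirkhoffSum T g (N + 1) x := by
  induction N generalizing x with
  | zero => exact maxBirkhoffSum_nonneg _ _
  | succ N ih => exact max_le_max le_rfl (by linarith [ih (T x)])

theorem maxBirkhoffSum_monotone (x : X) : Monotone fun N => maxBirkhoffSum T g N x :=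
  monotone_nat_of_le_succ fun N => maxBirkhoffSum_le_succ N x

theorem birkhoffSum_le_maxBirkhoffSum (N : ℕ) (x : X) :
    birkhoffSum T g N x ≤ maxBirkhoffSum T g N x := by
  induction N generalizing x with
  | zero => simp [maxBirkhoffSum]
  | succ N ih =>
    rw [birkhoffSum_succ']
    exact le_max_of_le_right (by linarith [ih (T x)])

/-- The two sums telescope to the difference g(Tⁿx) - g(x), at most 2M in absolute value. This makes
both the upper limits and the limit itself invariant under T. -/
theorem tendsto_average_sub_average_apply {M : ℝ} (hM : ∀ x, |g x| ≤ M) (x : X) :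
    Tendsto (fun n : ℕ => (1 / (n : ℝ)) * birkhoffSum T g n (T x) -
      (1 / (n : ℝ)) * birkhoffSum T g n x) atTop (𝓝 0) := by
  have h0 : Tendsto (fun n : ℕ => (1 / (n : ℝ)) * (2 * M)) atTop (𝓝 0) := by
    simpa using (tendsto_one_div_atTop_nhds_zero_nat (𝕜 := ℝ)).mul_const (2 * M)
  refine squeeze_zero_norm (fun n => ?_) h0
  rw [← mul_sub, birkhoffSum_apply_sub_birkhoffSum, norm_mul, Real.norm_eq_abs, Real.norm_eq_abs,
    abs_of_nonneg (by positivity : (0 : ℝ) ≤ 1 / n)]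
  gcongr
  calc |g (T^[n] x) - g x| ≤ |g (T^[n] x)| + |g x| := abs_sub _ _
    _ ≤ 2 * M := by linarith [hM (T^[n] x), hM x]

/-- The limit superior of the averages of `g` along the orbit of `x` is bigger than `b`. -/
def LimsupGT (T : X → X) (g : X → ℝ) (b : ℝ) (x : X) : Prop :=
  ∃ c : ℚ, b < c ∧ ∃ᶠ n : ℕ in atTop, (c : ℝ) < (1 / (n : ℝ)) * birkhoffSum T g n x

/-- The gap between b and the rational c in `LimsupGT` absorbs a perturbation that tends to 0.
Rationality of c also keeps the set measurable as a countable union. -/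
theorem limsupGT_of_tendsto_sub {b : ℝ} {x y : X}
    (h : Tendsto (fun n : ℕ => (1 / (n : ℝ)) * birkhoffSum T g n y -
      (1 / (n : ℝ)) * birkhoffSum T g n x) atTop (𝓝 0)) (hx : LimsupGT T g b x) :
    LimsupGT T g b y := by
  obtain ⟨c, hbc, hc⟩ := hx
  obtain ⟨d, hbd, hdc⟩ := exists_rat_btwn hbc
  refine ⟨d, hbd, (hc.and_eventually (h.eventually (lt_mem_nhds
    (show (d : ℝ) - c < 0 by linarith)))).mono ?_⟩
  rintro n ⟨h1, h2⟩
  linarith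

theorem limsupGT_apply_iff {M : ℝ} (hM : ∀ x, |g x| ≤ M) {b : ℝ} {x : X} :
    LimsupGT T g b (T x) ↔ LimsupGT T g b x := by
  have h := tendsto_average_sub_average_apply (T := T) hM x
  refine ⟨limsupGT_of_tendsto_sub ?_, limsupGT_of_tendsto_sub h⟩
  simpa using h.neg

theorem LimsupGT.exists_pos {b : ℝ} {x : X} (h : LimsupGT T g b x) :
    ∃ n : ℕ, 0 < birkhoffSum T g n x - n * b := by
  obtain ⟨c, hbc, hc⟩ := h
  obtain ⟨n, hn, hpos⟩ := (hc.and_eventually (eventually_gt_atTop 0)).exists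
  refine ⟨n, ?_⟩
  have hn0 : (0 : ℝ) < n := by exact_mod_cast hpos
  have h1 : b < (1 / (n : ℝ)) * birkhoffSum T g n x := hbc.trans hn
  rw [one_div, ← div_eq_inv_mul, lt_div_iff₀ hn0] at h1
  linarith

variable [MeasurableSpace X] {μ : Measure X}

theorem measurable_maxBirkhoffSum (hT : Measurable T) (hg : Measurable g) (N : ℕ) :
    Measurable (maxBirkhoffSum T g N) := by
  induction N with
  | zero => exact measurable_const
  | succ N ih => exact measurable_const.max (hg.add (ih.comp hT))

theorem integrable_maxBirkhoffSum (hT : MeasurePreserving T μ μ) (hg : Integrable g μ) (N : ℕ) :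
    Integrable (maxBirkhoffSum T g N) μ := by
  induction N with
  | zero => exact integrable_zero _ _ _
  | succ N ih =>
    exact (integrable_zero _ _ _).sup (hg.add (hT.integrable_comp_of_integrable ih))

/-- A form of the maximal ergodic theorem. -/
theorem integral_nonneg_of_exists_birkhoffSum_pos (hT : MeasurePreserving T μ μ)
    (hgm : Measurable g) (hg : Integrable g μ)
    (h : ∀ x, g x ≠ 0 → ∃ n, 0 < birkhoffSum T g n x) : 0 ≤ ∫ x, g x ∂μ := by
  have hmeas : ∀ N, MeasurableSet {x | 0 < maxBirkhoffSum T g N x} := fun N =>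
    measurableSet_lt measurable_const (measurable_maxBirkhoffSum hT.measurable hgm N)
  have hstep : ∀ N, 0 ≤ ∫ x, {x | 0 < maxBirkhoffSum T g (N + 1) x}.indicator g x ∂μ := by
    intro N
    have hi := integrable_maxBirkhoffSum hT hg (N + 1)
    have hi' := hT.integrable_comp_of_integrable hi
    have hint : ∫ x, (maxBirkhoffSum T g (N + 1) x - maxBirkhoffSum T g (N + 1) (T x)) ∂μ = 0 := by
      have hc : ∫ x, maxBirkhoffSum T g (N + 1) (T x) ∂μ = ∫ x, maxBirkhoffSum T g (N + 1) x ∂μ := by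
        conv_rhs => rw [← hT.map_eq]
        rw [integral_map hT.measurable.aemeasurable (by
          rw [hT.map_eq]; exact hi.aestronglyMeasurable)]
      exact (integral_sub hi hi').trans (by simp [hc])
    -- Write M for the maximum with index N + 1. Where M > 0, M = g + (maximum with index N) ∘ T ≤ g
    -- + M ∘ T; elsewhere M = 0 ≤ M ∘ T. So M - M ∘ T, of integral 0, is at most g on {M > 0} and at
    -- most 0 off it.
    refine hint.symm.trans_le <| integral_mono (hi.sub hi') (hg.indicator (hmeas _)) fun x => ?_
    by_cases hx : 0 < maxBirkhoffSum T g (N + 1) x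
    · have h1 : maxBirkhoffSum T g (N + 1) x = g x + maxBirkhoffSum T g N (T x) :=
        max_eq_right_of_lt ((lt_max_iff.1 hx).resolve_left (lt_irrefl _))
      simp only [indicator, mem_ofPred_eq, hx, if_true]
      linarith [maxBirkhoffSum_le_succ (T := T) (g := g) N (T x)]
    · simp only [indicator, mem_ofPred_eq, hx, if_false]
      linarith [maxBirkhoffSum_nonneg (T := T) (g := g) (N + 1) (T x)]
  -- As N grows, the sets {M > 0} eventually contain every point where g ≠ 0, so the truncations
  -- converge to g, dominated by |g|.
  refine ge_of_tendsto' (tendsto_integral_of_dominated_convergence (fun x => ‖g x‖)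
    (fun N => (hg.indicator (hmeas (N + 1))).aestronglyMeasurable) hg.norm
    (fun N => Eventually.of_forall fun x => norm_indicator_le_norm_self _ _)
    (Eventually.of_forall fun x => ?_)) hstep
  by_cases hx : g x = 0
  · simp [indicator, hx]
  · obtain ⟨n, hn⟩ := h x hx
    refine tendsto_const_nhds.congr' ((eventually_ge_atTop n).mono fun N hN => ?_)
    have : 0 < maxBirkhoffSum T g (N + 1) x :=
      (hn.trans_le (birkhoffSum_le_maxBirkhoffSum n x)).trans_le
        (maxBirkhoffSum_monotone x (by omega))
    simp [indicator, this]

theorem measurable_birkhoffSum (hT : Measurable T) (hg : Measurable g) (n : ℕ) :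
    Measurable (birkhoffSum T g n) := by
  unfold birkhoffSum
  exact Finset.measurable_fun_sum _ fun k _ => hg.comp (hT.iterate k)

theorem measurableSet_limsupGT (hT : Measurable T) (hg : Measurable g) (b : ℝ) :
    MeasurableSet {x | LimsupGT T g b x} := by
  simp only [LimsupGT, frequently_atTop, ofPred_exists, ofPred_and, ofPred_forall]
  refine MeasurableSet.iUnion fun c => (MeasurableSet.const _).inter
    (MeasurableSet.iInter fun N => MeasurableSet.iUnion fun n => (MeasurableSet.const _).inter ?_)
  exact measurableSet_lt measurable_const ((measurable_birkhoffSum hT hg n).const_mul _)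

/-- The maximal ergodic theorem is applied to g - b cut off outside E. As E is invariant, the orbit
of a point of E never meets the cutoff, and an upper limit above b makes some sum of g - b positive.
-/
theorem setIntegral_sub_const_nonneg [IsFiniteMeasure μ] (hT : MeasurePreserving T μ μ)
    (hgm : Measurable g) {M : ℝ} (hM : ∀ x, |g x| ≤ M) {E : Set X} (hE : MeasurableSet E)
    (hinv : ∀ x, T x ∈ E ↔ x ∈ E) {b : ℝ} (hb : ∀ x ∈ E, LimsupGT T g b x) :
    b * μ.real E ≤ ∫ x in E, g x ∂μ := by
  have hg : Integrable g μ := Integrable.of_bound hgm.aestronglyMeasurable M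
    (Eventually.of_forall hM)
  have hgb : Integrable (fun x => g x - b) μ := hg.sub (integrable_const b)
  have hsum : ∀ x ∈ E, ∀ n : ℕ, birkhoffSum T (E.indicator fun x => g x - b) n x =
      birkhoffSum T g n x - n * b := by
    intro x hx n
    have hit : ∀ k, T^[k] x ∈ E := by
      intro k
      induction k with
      | zero => exact hx
      | succ k ih => rw [Function.iterate_succ_apply']; exact (hinv _).2 ih
    simp [birkhoffSum, hit]
  have key : 0 ≤ ∫ x, E.indicator (fun x => g x - b) x ∂μ := by
    refine integral_nonneg_of_exists_birkhoffSum_pos hT ((hgm.sub_const b).indicator hE)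
      (hgb.indicator hE) fun x hx => ?_
    have hxE : x ∈ E := mem_of_indicator_ne_zero hx
    obtain ⟨n, hn⟩ := (hb x hxE).exists_pos
    exact ⟨n, by rwa [hsum x hxE n]⟩
  rw [integral_indicator hE, integral_sub hg.integrableOn (integrableOn_const (by finiteness)),
    setIntegral_const, smul_eq_mul] at key
  linarith [mul_comm b (μ.real E)]

/-- Birkhoff's pointwise ergodic theorem for bounded functions. -/
theorem ae_exists_tendsto_birkhoff [IsFiniteMeasure μ] (hT : MeasurePreserving T μ μ)
    (hgm : Measurable g) {M : ℝ} (hM : ∀ x, |g x| ≤ M) :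
    ∀ᵐ x ∂μ, ∃ u, Tendsto (fun n : ℕ => (1 / (n : ℝ)) * birkhoffSum T g n x) atTop (𝓝 u) := by
  have hM' : ∀ x, |(-g) x| ≤ M := fun x => by simpa using hM x
  have hnull : ∀ a b : ℚ, a < b →
      ∀ᵐ x ∂μ, ¬ (LimsupGT T (-g) (-a) x ∧ LimsupGT T g b x) := by
    intro a b hab
    set E := {x | LimsupGT T (-g) (-a) x ∧ LimsupGT T g b x} with hEdef
    have hE : MeasurableSet E := (measurableSet_limsupGT hT.measurable hgm.neg _).inter
      (measurableSet_limsupGT hT.measurable hgm _)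
    have hinv : ∀ x, T x ∈ E ↔ x ∈ E := fun x =>
      and_congr (limsupGT_apply_iff hM') (limsupGT_apply_iff hM)
    have h1 := setIntegral_sub_const_nonneg hT hgm hM hE hinv fun x hx => hx.2
    have h2 := setIntegral_sub_const_nonneg hT hgm.neg hM' hE hinv fun x hx => hx.1
    simp only [Pi.neg_apply, integral_neg] at h2
    have hab' : (a : ℝ) < b := by exact_mod_cast hab
    -- The two bounds say b μ(E) ≤ ∫_E g ≤ a μ(E), while a < b.
    have h3 : μ.real E = 0 := by
      have := measureReal_nonneg (μ := μ) (s := E)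
      nlinarith
    rw [measureReal_eq_zero_iff] at h3
    exact measure_eq_zero_iff_ae_notMem.1 h3
  have hall : ∀ᵐ x ∂μ, ∀ a b : ℚ, a < b → ¬ (LimsupGT T (-g) (-a) x ∧ LimsupGT T g b x) := by
    simpa only [ae_all_iff] using hnull
  filter_upwards [hall] with x hx
  have hbound : ∀ n : ℕ, |(1 / (n : ℝ)) * birkhoffSum T g n x| ≤ M := by
    intro n
    have hM0 : 0 ≤ M := (abs_nonneg _).trans (hM x)
    rcases n.eq_zero_or_pos with rfl | hn
    · simpa using hM0
    have hn0 : (0 : ℝ) < n := by exact_mod_cast hn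
    rw [abs_mul, abs_of_pos (by positivity : (0 : ℝ) < 1 / n), one_div, inv_mul_le_iff₀ hn0]
    calc |birkhoffSum T g n x| ≤ ∑ k ∈ Finset.range n, |g (T^[k] x)| :=
          Finset.abs_sum_le_sum_abs _ _
      _ ≤ ∑ k ∈ Finset.range n, M := Finset.sum_le_sum fun k _ => hM _
      _ = n * M := by simp
  refine tendsto_of_no_upcrossings Rat.isDenseEmbedding_coe_real.dense ?_
    (isBoundedUnder_of ⟨M, fun n => (abs_le.1 (hbound n)).2⟩)
    (isBoundedUnder_of ⟨-M, fun n => (abs_le.1 (hbound n)).1⟩)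
  rintro _ ⟨a, rfl⟩ _ ⟨b, rfl⟩ hab ⟨h1, h2⟩
  -- Since `LimsupGT` needs a strict gap, the thresholds are moved inwards to a < a' < b' < b; then
  -- -a and b serve as the rational witnesses.
  obtain ⟨a', ha1, ha2⟩ := exists_rat_btwn hab
  obtain ⟨b', hb1, hb2⟩ := exists_rat_btwn ha2
  refine hx a' b' (by exact_mod_cast hb1) ⟨⟨-a, by push_cast; linarith, h1.mono fun n hn => ?_⟩,
    b, hb2, h2⟩
  rw [birkhoffSum_neg, mul_neg]
  push_cast
  linarith

end Birkhoff

/-! ### Billiard steps as pairs of visible footpoints -/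

/-- The chord from `γ s` to `γ s'`, in the frame of the tangent and the inner normal at `s`. -/
def chordVector (γ : ℝ → ℂ) (s s' : ℝ) : ℂ := (γ s' - γ s) * conj (deriv γ s)

/-- The angle between the tangent at `γ s` and the chord from `γ s` to `γ s'`. -/
def chordAngle (γ : ℝ → ℂ) (s s' : ℝ) : ℝ := (chordVector γ s s').arg

/-- The pairs of footpoints that are joined by a transversal chord inside `Ω`. -/
def visiblePairs (Ω : Set ℂ) (L : ℝ) (γ : ℝ → ℂ) : Set (ℝ × ℝ) :=
  {p | p.1 ∈ Ico 0 L ∧ p.2 ∈ Ico 0 L ∧ DifferentiableAt ℝ γ p.1 ∧ DifferentiableAt ℝ γ p.2 ∧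
    0 < (chordVector γ p.1 p.2).im ∧ 0 < (chordVector γ p.2 p.1).im ∧
    ∀ r ∈ Ioo (0 : ℝ) 1, γ p.1 + (r : ℂ) * (γ p.2 - γ p.1) ∈ Ω}

/-- The phase point whose forward trajectory is the chord between two visible footpoints. -/
def chordPhase (γ : ℝ → ℂ) (p : ℝ × ℝ) : ℝ × ℝ := (p.1, chordAngle γ p.1 p.2)

/-- The reversal of the direction, seen after the reflection in the boundary. -/
def flipAngle (z : ℝ × ℝ) : ℝ × ℝ := (z.1, Real.pi - z.2)

theorem arg_mem_Ioo_of_im_pos {w : ℂ} (hw : 0 < w.im) : w.arg ∈ Ioo 0 Real.pi :=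
  ⟨(Complex.arg_nonneg_iff.2 hw.le).lt_of_ne fun h =>
      hw.ne' (Complex.arg_eq_zero_iff.1 h.symm).2,
    (Complex.arg_le_pi w).lt_of_ne fun h => hw.ne' (Complex.arg_eq_pi_iff.1 h).2⟩

theorem mul_conj_of_norm_eq_one {τ : ℂ} (h : ‖τ‖ = 1) : τ * conj τ = 1 := by
  rw [Complex.mul_conj, Complex.normSq_eq_norm_sq, h]; norm_num

theorem norm_chordVector {γ : ℝ → ℂ} {s : ℝ} (h : ‖deriv γ s‖ = 1) (s' : ℝ) :
    ‖chordVector γ s s'‖ = ‖γ s' - γ s‖ := by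
  rw [chordVector, norm_mul, Complex.norm_conj, h, mul_one]

theorem norm_mul_direction_chordPhase {γ : ℝ → ℂ} {s : ℝ} (h : ‖deriv γ s‖ = 1) (s' : ℝ) :
    (‖γ s' - γ s‖ : ℂ) * direction γ (chordPhase γ (s, s')) = γ s' - γ s := by
  have h1 := Complex.norm_mul_exp_arg_mul_I (chordVector γ s s')
  rw [norm_chordVector h] at h1
  simp only [direction, chordPhase, chordAngle]
  calc _ = deriv γ s * ((‖γ s' - γ s‖ : ℂ) *
        Complex.exp ((chordVector γ s s').arg * Complex.I)) := by ring
    _ = (deriv γ s * conj (deriv γ s)) * (γ s' - γ s) := by rw [h1, chordVector]; ring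
    _ = _ := by rw [mul_conj_of_norm_eq_one h, one_mul]

theorem exp_pi_sub_mul_I (θ : ℝ) :
    Complex.exp (((Real.pi - θ : ℝ) : ℂ) * Complex.I) = - conj (Complex.exp (θ * Complex.I)) := by
  rw [← Complex.exp_conj, map_mul, Complex.conj_ofReal, Complex.conj_I, Complex.ofReal_sub,
    sub_mul, sub_eq_add_neg, Complex.exp_add, Complex.exp_pi_mul_I]
  simp

/-- At s' the reversed chord has direction -v. Reflecting v in the tangent there is the same as
reflecting -v in the normal, which sends the angle of the reversed chord to its supplement. -/
theorem isStep_of_mem_visiblePairs {Ω : Set ℂ} {L : ℝ} {γ : ℝ → ℂ}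
    (hb : IsArclengthBoundary Ω L γ) {p : ℝ × ℝ} (hp : p ∈ visiblePairs Ω L γ) :
    IsStep Ω L γ (chordPhase γ p) (flipAngle (chordPhase γ p.swap)) := by
  obtain ⟨s, s'⟩ := p
  obtain ⟨h1, h2, d1, d2, i1, i2, hr⟩ := hp
  dsimp only at h1 h2 d1 d2 i1 i2 hr
  have n1 := hb.norm_deriv h1 d1
  have n2 := hb.norm_deriv h2 d2
  have a1 := arg_mem_Ioo_of_im_pos i1
  have a2 := arg_mem_Ioo_of_im_pos i2
  have hne : γ s' - γ s ≠ 0 := by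
    intro h; simp [chordVector, h] at i1
  have hpos : 0 < ‖γ s' - γ s‖ := norm_pos_iff.2 hne
  have hc : (‖γ s' - γ s‖ : ℂ) ≠ 0 := by exact_mod_cast hpos.ne'
  have e1 := norm_mul_direction_chordPhase n1 s'
  have e2 := norm_mul_direction_chordPhase n2 s
  rw [norm_sub_rev] at e2
  refine ⟨h1, a1, d1, h2, ⟨sub_pos.2 a2.2, sub_lt_self _ a2.1⟩, d2,
    ⟨‖γ s' - γ s‖, hpos, ?_, ?_⟩, ?_⟩
  · rw [e1]; simp [flipAngle, chordPhase]
  · rintro r ⟨r0, r1⟩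
    have := hr (r / ‖γ s' - γ s‖) ⟨by positivity, (div_lt_one hpos).2 r1⟩
    have e : (r : ℂ) * direction γ (chordPhase γ (s, s')) =
        ((r / ‖γ s' - γ s‖ : ℝ) : ℂ) * (γ s' - γ s) := by
      nth_rewrite 2 [← e1]
      rw [← mul_assoc, Complex.ofReal_div, div_mul_cancel₀ _ hc]
    rw [e]
    exact this
  · have e3 : direction γ (chordPhase γ (s', s)) = - direction γ (chordPhase γ (s, s')) := by
      apply mul_left_cancel₀ hc
      rw [e2, mul_neg, e1]; ring
    have e4 : conj (Complex.exp ((chordAngle γ s' s : ℝ) * Complex.I)) =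
        - (deriv γ s' * conj (direction γ (chordPhase γ (s, s')))) := by
      have : conj (direction γ (chordPhase γ (s', s))) =
          - conj (direction γ (chordPhase γ (s, s'))) := by rw [e3, map_neg]
      rw [← mul_neg, ← this, direction, map_mul, ← mul_assoc]
      simp only [chordPhase]
      rw [mul_conj_of_norm_eq_one n2, one_mul]
    simp only [Prod.swap]
    rw [direction]
    simp only [flipAngle]
    rw [exp_pi_sub_mul_I]
    simp only [chordPhase] at e4 ⊢
    rw [e4, reflect]
    ring

theorem arg_mul_exp_mul_I {t θ : ℝ} (ht : 0 < t) (hθ : θ ∈ Ioo 0 Real.pi) :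
    ((t : ℂ) * Complex.exp (θ * Complex.I)).arg = θ := by
  rw [Complex.arg_real_mul _ ht, Complex.arg_exp_mul_I, toIocMod_eq_self]
  constructor <;> linarith [hθ.1, hθ.2, Real.pi_pos]

theorem im_mul_exp_mul_I_pos {t θ : ℝ} (ht : 0 < t) (hθ : θ ∈ Ioo 0 Real.pi) :
    0 < ((t : ℂ) * Complex.exp (θ * Complex.I)).im := by
  rw [Complex.im_ofReal_mul, Complex.exp_ofReal_mul_I_im]
  exact mul_pos ht (Real.sin_pos_of_mem_Ioo hθ)

theorem chordVector_eq_of_eq_add {γ : ℝ → ℂ} {s s' t θ : ℝ} (n1 : ‖deriv γ s‖ = 1)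
    (e : γ s' = γ s + t * direction γ (s, θ)) :
    chordVector γ s s' = (t : ℂ) * Complex.exp (θ * Complex.I) := by
  rw [chordVector, e, direction]
  linear_combination ((t : ℂ) * Complex.exp (θ * Complex.I)) * mul_conj_of_norm_eq_one n1

theorem IsStep.mem_visiblePairs {Ω : Set ℂ} {L : ℝ} {γ : ℝ → ℂ}
    (hb : IsArclengthBoundary Ω L γ) {z z' : ℝ × ℝ} (h : IsStep Ω L γ z z') :
    (z.1, z'.1) ∈ visiblePairs Ω L γ ∧ chordPhase γ (z.1, z'.1) = z := by
  obtain ⟨s, θ⟩ := z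
  obtain ⟨s', θ'⟩ := z'
  obtain ⟨h1, a1, d1, h2, a2, d2, ⟨t, ht, e, hr⟩, hrefl⟩ := h
  dsimp only at h1 a1 d1 h2 a2 d2 e hr hrefl ⊢
  have n1 := hb.norm_deriv h1 d1
  have n2 := hb.norm_deriv h2 d2
  have m2 := mul_conj_of_norm_eq_one n2
  have hw : γ s' - γ s = t * direction γ (s, θ) := by rw [e]; ring
  have c1 := chordVector_eq_of_eq_add n1 e
  have hexp : deriv γ s' * conj (direction γ (s, θ)) = Complex.exp (θ' * Complex.I) := by
    have hne : deriv γ s' ≠ 0 := by rw [← norm_ne_zero_iff, n2]; exact one_ne_zero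
    rw [direction, reflect, sq, mul_assoc] at hrefl
    exact (mul_left_cancel₀ hne hrefl).symm
  have c2 : chordVector γ s' s = (t : ℂ) * Complex.exp ((Real.pi - θ' : ℝ) * Complex.I) := by
    rw [exp_pi_sub_mul_I, ← hexp, map_mul, Complex.conj_conj, chordVector,
      ← neg_sub, hw]
    ring
  have a2' : Real.pi - θ' ∈ Ioo 0 Real.pi := ⟨by linarith [a2.2], by linarith [a2.1]⟩
  refine ⟨⟨h1, h2, d1, d2, ?_, ?_, ?_⟩, ?_⟩
  · dsimp only; rw [c1]; exact im_mul_exp_mul_I_pos ht a1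
  · dsimp only; rw [c2]; exact im_mul_exp_mul_I_pos ht a2'
  · rintro r ⟨r0, r1⟩
    have := hr (r * t) ⟨by positivity, by nlinarith⟩
    dsimp only
    rw [hw]
    convert this using 2
    push_cast; ring
  · rw [chordPhase, chordAngle, c1, arg_mul_exp_mul_I ht a1]

theorem image_chordPhase {Ω : Set ℂ} {L : ℝ} {γ : ℝ → ℂ} (hb : IsArclengthBoundary Ω L γ) :
    chordPhase γ '' visiblePairs Ω L γ = regularSet Ω L γ := by
  ext z
  constructor
  · rintro ⟨p, hp, rfl⟩
    exact ⟨_, isStep_of_mem_visiblePairs hb hp⟩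
  · rintro ⟨z', h⟩
    exact ⟨_, (h.mem_visiblePairs hb).1, (h.mem_visiblePairs hb).2⟩

theorem billiardMap_chordPhase {Ω : Set ℂ} {L : ℝ} {γ : ℝ → ℂ} (hT : IsTable Ω L γ) {p : ℝ × ℝ}
    (hp : p ∈ visiblePairs Ω L γ) :
    billiardMap Ω L γ (chordPhase γ p) = flipAngle (chordPhase γ p.swap) :=
  billiardMap_eq hT (isStep_of_mem_visiblePairs hT.boundary hp)

/-- The phase point determines its successor, whose footpoint is the second entry of the pair. -/
theorem injOn_chordPhase {Ω : Set ℂ} {L : ℝ} {γ : ℝ → ℂ} (hT : IsTable Ω L γ) :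
    InjOn (chordPhase γ) (visiblePairs Ω L γ) := by
  intro p hp q hq h
  have h2 := congrArg (billiardMap Ω L γ) h
  rw [billiardMap_chordPhase hT hp, billiardMap_chordPhase hT hq] at h2
  exact Prod.ext (Prod.ext_iff.1 h).1 (Prod.ext_iff.1 h2).1

theorem swap_mem_visiblePairs {Ω : Set ℂ} {L : ℝ} {γ : ℝ → ℂ} {p : ℝ × ℝ}
    (hp : p ∈ visiblePairs Ω L γ) : p.swap ∈ visiblePairs Ω L γ := by
  obtain ⟨h1, h2, d1, d2, i1, i2, hr⟩ := hp
  refine ⟨h2, h1, d2, d1, i2, i1, fun r hr' => ?_⟩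
  have := hr (1 - r) ⟨by linarith [hr'.2], by linarith [hr'.1]⟩
  convert this using 1
  simp only [Prod.fst_swap, Prod.snd_swap]
  push_cast; ring

/-! ### Measurability of the billiard map -/

theorem measurable_chordVector {γ : ℝ → ℂ} (hγ : Continuous γ) :
    Measurable fun p : ℝ × ℝ => chordVector γ p.1 p.2 := by
  have h1 := measurable_deriv γ
  have h2 := hγ.measurable
  have h3 : Measurable fun p : ℝ × ℝ => conj (deriv γ p.1) :=
    Complex.continuous_conj.measurable.comp (h1.comp measurable_fst)
  exact ((h2.comp measurable_snd).sub (h2.comp measurable_fst)).mul h3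

theorem measurable_chordPhase {γ : ℝ → ℂ} (hγ : Continuous γ) : Measurable (chordPhase γ) :=
  measurable_fst.prodMk (Complex.measurable_arg.comp (measurable_chordVector hγ))

theorem measurable_flipAngle : Measurable flipAngle :=
  measurable_fst.prodMk (measurable_const.sub measurable_snd)

theorem measurableSet_visiblePairs {Ω : Set ℂ} {L : ℝ} {γ : ℝ → ℂ} (hΩ : IsOpen Ω)
    (hγ : Continuous γ) : MeasurableSet (visiblePairs Ω L γ) := by
  have hv := measurable_chordVector hγ
  have hd : MeasurableSet {s | DifferentiableAt ℝ γ s} := measurableSet_of_differentiableAt ℝ γ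
  have hseg : MeasurableSet {p : ℝ × ℝ | ∀ r ∈ Ioo (0 : ℝ) 1,
      γ p.1 + (r : ℂ) * (γ p.2 - γ p.1) ∈ Ω} := by
    -- The endpoints of the chord lie on the boundary, so the condition on the open interval need
    -- not be an open one. On each compact subinterval it is open, by the tube lemma.
    have heq : {p : ℝ × ℝ | ∀ r ∈ Ioo (0 : ℝ) 1, γ p.1 + (r : ℂ) * (γ p.2 - γ p.1) ∈ Ω} =
        ⋂ n : ℕ, {p : ℝ × ℝ | ∀ r ∈ Icc (1 / ((n : ℝ) + 1)) (1 - 1 / ((n : ℝ) + 1)),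
          γ p.1 + (r : ℂ) * (γ p.2 - γ p.1) ∈ Ω} := by
      ext p
      simp only [mem_iInter, mem_ofPred_eq]
      constructor
      · intro h n r hr
        have : (0 : ℝ) < 1 / ((n : ℝ) + 1) := by positivity
        exact h r ⟨by linarith [hr.1], by linarith [hr.2]⟩
      · intro h r hr
        obtain ⟨n, hn⟩ := exists_nat_one_div_lt (lt_min hr.1 (sub_pos.2 hr.2))
        exact h n r ⟨(hn.trans_le (min_le_left _ _)).le,
          by linarith [hn.trans_le (min_le_right r (1 - r))]⟩
    rw [heq]
    refine MeasurableSet.iInter fun n => IsOpen.measurableSet ?_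
    rw [isOpen_iff_eventually]
    intro p hp
    refine isCompact_Icc.eventually_forall_of_forall_eventually fun r hr => ?_
    have hc : Continuous fun q : (ℝ × ℝ) × ℝ => γ q.1.1 + (q.2 : ℂ) * (γ q.1.2 - γ q.1.1) := by
      fun_prop
    exact hc.continuousAt.eventually (hΩ.mem_nhds (hp r hr))
  exact (measurable_fst measurableSet_Ico).inter ((measurable_snd measurableSet_Ico).inter
    ((measurable_fst hd).inter ((measurable_snd hd).inter
    ((measurableSet_lt measurable_const (Complex.measurable_im.comp hv)).inter
    ((measurableSet_lt measurable_const (Complex.measurable_im.comp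
      (hv.comp measurable_swap))).inter hseg)))))

/-- An injective measurable image of a Borel set is Borel (Lusin–Souslin). -/
theorem measurableSet_regularSet {Ω : Set ℂ} {L : ℝ} {γ : ℝ → ℂ} (hT : IsTable Ω L γ) :
    MeasurableSet (regularSet Ω L γ) := by
  rw [← image_chordPhase hT.boundary]
  exact (measurableSet_visiblePairs hT.isOpen hT.boundary.continuous).image_of_measurable_injOn
    (measurable_chordPhase hT.boundary.continuous) (injOn_chordPhase hT)

theorem measurable_billiardMap {Ω : Set ℂ} {L : ℝ} {γ : ℝ → ℂ} (hT : IsTable Ω L γ) :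
    Measurable (billiardMap Ω L γ) := by
  have hm := measurable_chordPhase hT.boundary.continuous
  have hV := measurableSet_visiblePairs (L := L) hT.isOpen hT.boundary.continuous
  intro A hA
  -- Outside the regular set the map is the identity by its default value, which contributes the
  -- last term.
  have hpre : billiardMap Ω L γ ⁻¹' A =
      chordPhase γ '' (visiblePairs Ω L γ ∩
        (fun p => flipAngle (chordPhase γ p.swap)) ⁻¹' A) ∪ ((regularSet Ω L γ)ᶜ ∩ A) := by
    ext z
    by_cases hz : z ∈ regularSet Ω L γ
    · simp only [mem_preimage, mem_union, mem_inter_iff, mem_compl_iff, hz, not_true_eq_false,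
        false_and, or_false]
      constructor
      · intro h
        obtain ⟨p, hp, rfl⟩ := (image_chordPhase hT.boundary).symm ▸ hz
        exact ⟨p, ⟨hp, by rwa [mem_preimage, ← billiardMap_chordPhase hT hp]⟩, rfl⟩
      · rintro ⟨p, ⟨hp, hA⟩, rfl⟩
        rw [billiardMap_chordPhase hT hp]; exact hA
    · have hz' : billiardMap Ω L γ z = z := dif_neg hz
      simp only [mem_preimage, hz', mem_union, mem_inter_iff, mem_compl_iff, hz, not_false_eq_true,
        true_and]
      refine (or_iff_right ?_).symm
      rintro ⟨p, ⟨hp, -⟩, rfl⟩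
      exact hz ((image_chordPhase hT.boundary) ▸ mem_image_of_mem _ hp)
  rw [hpre]
  refine MeasurableSet.union ?_ ((measurableSet_regularSet hT).compl.inter hA)
  exact (hV.inter ((measurable_flipAngle.comp (hm.comp measurable_swap)) hA)
    ).image_of_measurable_injOn hm ((injOn_chordPhase hT).mono inter_subset_left)

/-! ### Invariance of the Liouville measure -/

/-- The density of the Liouville measure in the coordinates given by pairs of footpoints. -/
def chordKernel (γ : ℝ → ℂ) (p : ℝ × ℝ) : ℝ :=
  (chordVector γ p.1 p.2).im * (chordVector γ p.2 p.1).im / ‖γ p.2 - γ p.1‖ ^ 3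

theorem chordKernel_swap (γ : ℝ → ℂ) (p : ℝ × ℝ) : chordKernel γ p.swap = chordKernel γ p := by
  simp only [chordKernel, Prod.fst_swap, Prod.snd_swap]
  rw [norm_sub_rev, mul_comm]

/-- The angle is the imaginary part of the logarithm of the chord vector. In its logarithmic
derivative the constant factor conj γ'(s) cancels, leaving γ'(s') / (γ(s') - γ(s)). -/
theorem hasDerivAt_chordAngle {γ : ℝ → ℂ} {s s' : ℝ} (hs : ‖deriv γ s‖ = 1)
    (hd : DifferentiableAt ℝ γ s') (hpos : 0 < (chordVector γ s s').im) :
    HasDerivAt (chordAngle γ s) ((chordVector γ s' s).im / ‖γ s' - γ s‖ ^ 2) s' := by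
  have h1 : HasDerivAt (chordVector γ s) (deriv γ s' * conj (deriv γ s)) s' :=
    (hd.hasDerivAt.sub_const (γ s)).mul_const _
  have h2 := (h1.clog_real (Complex.mem_slitPlane_iff.2 (Or.inr hpos.ne')))
  have h3 := Complex.imCLM.hasFDerivAt.comp_hasDerivAt s' h2
  have hne : conj (deriv γ s) ≠ 0 := by
    rw [← norm_ne_zero_iff, Complex.norm_conj, hs]; exact one_ne_zero
  have heq : chordAngle γ s = Complex.imCLM ∘ fun t => Complex.log (chordVector γ s t) := by
    ext t; exact (Complex.log_im _).symm
  rw [heq]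
  refine h3.congr_deriv ?_
  rw [Complex.imCLM_apply, chordVector, chordVector, mul_div_mul_right _ _ hne, Complex.div_im,
    ← Complex.normSq_eq_norm_sq]
  simp only [Complex.mul_im, Complex.conj_re, Complex.conj_im, Complex.sub_re, Complex.sub_im]
  ring

theorem measurable_sin_snd :
    Measurable fun z : ℝ × ℝ => ENNReal.ofReal (Real.sin z.2) :=
  (Real.measurable_sin.comp measurable_snd).ennreal_ofReal

theorem liouville_apply (L : ℝ) {A : Set (ℝ × ℝ)} (hA : MeasurableSet A) :
    liouville L A = ∫⁻ z in A ∩ phaseSpace L, ENNReal.ofReal (Real.sin z.2) := by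
  rw [liouville, withDensity_apply _ hA, Measure.restrict_restrict hA]

theorem measurableSet_phaseSpace (L : ℝ) : MeasurableSet (phaseSpace L) :=
  measurableSet_Ico.prod measurableSet_Icc

theorem setLIntegral_eq_lintegral_slices {C : Set (ℝ × ℝ)} (hC : MeasurableSet C)
    {f : ℝ × ℝ → ENNReal} (hf : Measurable f) :
    ∫⁻ z in C, f z = ∫⁻ s, ∫⁻ t in Prod.mk s ⁻¹' C, f (s, t) := by
  rw [← lintegral_indicator hC, Measure.volume_eq_prod, lintegral_prod _
    (hf.indicator hC).aemeasurable]
  refine lintegral_congr fun s => ?_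
  rw [← lintegral_indicator (measurable_prodMk_left hC)]
  rfl

theorem measurable_chordKernel {γ : ℝ → ℂ} (hγ : Continuous γ) : Measurable (chordKernel γ) := by
  have hv := measurable_chordVector hγ
  have hn : Measurable fun p : ℝ × ℝ => ‖γ p.2 - γ p.1‖ ^ 3 := by
    apply Continuous.measurable; fun_prop
  exact ((Complex.measurable_im.comp hv).mul
    (Complex.measurable_im.comp (hv.comp measurable_swap))).div hn

theorem chordPhase_mem_phaseSpace {Ω : Set ℂ} {L : ℝ} {γ : ℝ → ℂ} {p : ℝ × ℝ}
    (hp : p ∈ visiblePairs Ω L γ) : chordPhase γ p ∈ phaseSpace L :=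
  ⟨hp.1, Ioo_subset_Icc_self (arg_mem_Ioo_of_im_pos hp.2.2.2.2.1)⟩

/-- The Liouville measure in the coordinates given by pairs of footpoints. -/
theorem liouville_image_chordPhase {Ω : Set ℂ} {L : ℝ} {γ : ℝ → ℂ} (hT : IsTable Ω L γ)
    {B : Set (ℝ × ℝ)} (hB : MeasurableSet B) (hBV : B ⊆ visiblePairs Ω L γ) :
    liouville L (chordPhase γ '' B) = ∫⁻ p in B, ENNReal.ofReal (chordKernel γ p) := by
  have hinj := (injOn_chordPhase hT).mono hBV
  have hC := hB.image_of_measurable_injOn (measurable_chordPhase hT.boundary.continuous) hinj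
  have hsub : chordPhase γ '' B ⊆ phaseSpace L := by
    rintro _ ⟨p, hp, rfl⟩
    exact chordPhase_mem_phaseSpace (hBV hp)
  rw [liouville_apply L hC, inter_eq_left.2 hsub, setLIntegral_eq_lintegral_slices hC
    measurable_sin_snd,
    setLIntegral_eq_lintegral_slices hB
    (measurable_chordKernel hT.boundary.continuous).ennreal_ofReal]
  refine lintegral_congr fun s => ?_
  have hslice : Prod.mk s ⁻¹' (chordPhase γ '' B) = chordAngle γ s '' (Prod.mk s ⁻¹' B) := by
    ext θ
    constructor
    · rintro ⟨⟨s₁, s'⟩, hp, h⟩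
      obtain ⟨rfl, rfl⟩ := Prod.ext_iff.1 h
      exact ⟨s', hp, rfl⟩
    · rintro ⟨s', hp, rfl⟩
      exact ⟨(s, s'), hp, rfl⟩
  have hBs : MeasurableSet (Prod.mk s ⁻¹' B) := measurable_prodMk_left hB
  have hinj' : InjOn (chordAngle γ s) (Prod.mk s ⁻¹' B) := by
    intro a ha b hb hab
    exact (Prod.ext_iff.1 (hinj ha hb (Prod.ext rfl hab))).2
  have hder : ∀ s' ∈ Prod.mk s ⁻¹' B, HasDerivWithinAt (chordAngle γ s)
      ((chordVector γ s' s).im / ‖γ s' - γ s‖ ^ 2) (Prod.mk s ⁻¹' B) s' := by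
    intro s' hs'
    obtain ⟨h1, h2, d1, d2, i1, i2, hr⟩ := hBV hs'
    exact (hasDerivAt_chordAngle (hT.boundary.norm_deriv h1 d1) d2 i1).hasDerivWithinAt
  rw [hslice, lintegral_image_eq_lintegral_abs_deriv_mul hBs hder hinj' _]
  refine setLIntegral_congr_fun hBs fun s' hs' => ?_
  obtain ⟨h1, h2, d1, d2, i1, i2, hr⟩ := hBV hs'
  have n1 := hT.boundary.norm_deriv h1 d1
  dsimp only at h1 h2 d1 d2 i1 i2 n1 ⊢
  -- Here sin θ is the normal component of the chord at s over its length, and the Jacobian is the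
  -- normal component at s' over the length squared; their product is the kernel.
  rw [abs_of_nonneg (by positivity), ← ENNReal.ofReal_mul (by positivity), chordAngle,
    Complex.sin_arg, norm_chordVector n1, chordKernel]
  congr 1
  dsimp only
  ring

theorem liouville_preimage_flipAngle (L : ℝ) {A : Set (ℝ × ℝ)} (hA : MeasurableSet A) :
    liouville L (flipAngle ⁻¹' A) = liouville L A := by
  have hmp : MeasurePreserving flipAngle (volume : Measure (ℝ × ℝ)) volume :=
    (MeasurePreserving.id volume).prod (Measure.measurePreserving_sub_left volume Real.pi)
  have hpre : flipAngle ⁻¹' A ∩ phaseSpace L = flipAngle ⁻¹' (A ∩ phaseSpace L) := by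
    ext ⟨s, θ⟩
    simp only [flipAngle, phaseSpace, mem_inter_iff, mem_preimage, mem_prod, mem_Icc]
    constructor <;> rintro ⟨h1, h2, h3, h4⟩ <;> exact ⟨h1, h2, by linarith, by linarith⟩
  rw [liouville_apply L (measurable_flipAngle hA), liouville_apply L hA, hpre,
    ← hmp.setLIntegral_comp_preimage (hA.inter (measurableSet_phaseSpace L))
    measurable_sin_snd]
  simp [flipAngle, Real.sin_pi_sub]

/-- The billiard map preserves the Liouville measure. -/
theorem measurePreserving_billiardMap {Ω : Set ℂ} {L : ℝ} {γ : ℝ → ℂ} (hT : IsTable Ω L γ)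
    (hnull : liouville L (regularSet Ω L γ)ᶜ = 0) :
    MeasurePreserving (billiardMap Ω L γ) (liouville L) (liouville L) := by
  refine ⟨measurable_billiardMap hT, Measure.ext fun A hA => ?_⟩
  have hm := measurable_chordPhase hT.boundary.continuous
  have hV := measurableSet_visiblePairs (L := L) hT.isOpen hT.boundary.continuous
  -- B describes the flipped preimage of A in footpoint coordinates. The billiard preimage is then B
  -- with its coordinates swapped, so the symmetric kernel gives both the same measure.
  set B : Set (ℝ × ℝ) := visiblePairs Ω L γ ∩ (fun p => flipAngle (chordPhase γ p)) ⁻¹' A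
  have hB : MeasurableSet B := hV.inter ((measurable_flipAngle.comp hm) hA)
  have hsw : Prod.swap ⁻¹' B ⊆ visiblePairs Ω L γ := fun p hp => swap_mem_visiblePairs hp.1
  have h1 : billiardMap Ω L γ ⁻¹' A ∩ regularSet Ω L γ = chordPhase γ '' (Prod.swap ⁻¹' B) := by
    ext z
    constructor
    · rintro ⟨hz, hR⟩
      obtain ⟨p, hp, rfl⟩ := (image_chordPhase hT.boundary).symm ▸ hR
      exact ⟨p, ⟨swap_mem_visiblePairs hp, by rwa [mem_preimage, billiardMap_chordPhase hT hp] at hz⟩,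
        rfl⟩
    · rintro ⟨p, hp, rfl⟩
      refine ⟨?_, (image_chordPhase hT.boundary) ▸ mem_image_of_mem _ (hsw hp)⟩
      rw [mem_preimage, billiardMap_chordPhase hT (hsw hp)]
      exact hp.2
  have h2 : flipAngle ⁻¹' A ∩ regularSet Ω L γ = chordPhase γ '' B := by
    rw [← image_chordPhase hT.boundary]
    ext z
    constructor
    · rintro ⟨hz, p, hp, rfl⟩
      exact ⟨p, ⟨hp, hz⟩, rfl⟩
    · rintro ⟨p, hp, rfl⟩
      exact ⟨hp.2, p, hp.1, rfl⟩
  have hswap : MeasurePreserving (Prod.swap : ℝ × ℝ → ℝ × ℝ) volume volume :=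
    Measure.measurePreserving_swap
  have hres : ∀ C, liouville L (C ∩ regularSet Ω L γ) = liouville L C := fun C =>
    measure_inter_conull hnull
  rw [Measure.map_apply (measurable_billiardMap hT) hA,
    ← hres _ , h1,
    liouville_image_chordPhase hT (measurable_swap hB) hsw,
    ← liouville_preimage_flipAngle L hA,
    ← hres _, h2,
    liouville_image_chordPhase hT hB inter_subset_left,
    ← hswap.setLIntegral_comp_preimage hB
    (measurable_chordKernel hT.boundary.continuous).ennreal_ofReal]
  simp only [chordKernel_swap]

/-! ### Almost every phase point is regular -/

theorem IsArclengthBoundary.exists_finite_differentiableAt {Ω : Set ℂ} {L : ℝ} {γ : ℝ → ℂ}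
    (hb : IsArclengthBoundary Ω L γ) :
    ∃ F : Set ℝ, F.Finite ∧ ∀ s ∈ Ico 0 L, s ∉ F → DifferentiableAt ℝ γ s := by
  obtain ⟨n, a, h0, hn, ha⟩ := hb.piecewise
  have key : ∀ m ≤ n, ∀ s, 0 ≤ s → s < a m → ∃ i < n, s ∈ Icc (a i) (a (i + 1)) := by
    intro m
    induction m with
    | zero => intro _ s hs h; rw [h0] at h; exact absurd hs (not_le.2 h)
    | succ m ih =>
      intro hm s hs h
      by_cases hc : s < a m
      · exact ih (by omega) s hs hc
      · exact ⟨m, by omega, not_lt.1 hc, h.le⟩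
  refine ⟨a '' Iic n, (finite_Iic n).image a, fun s hs hF => ?_⟩
  obtain ⟨i, hi, hsi⟩ := key n le_rfl s hs.1 (by rw [hn]; exact hs.2)
  have h1 : a i ≠ s := fun h => hF ⟨i, hi.le, h⟩
  have h2 : a (i + 1) ≠ s := fun h => hF ⟨i + 1, Nat.succ_le_of_lt hi, h⟩
  exact ((ha i hi).2.1.differentiableOn one_ne_zero).differentiableAt
    (Icc_mem_nhds (hsi.1.lt_of_ne h1) (hsi.2.lt_of_ne h2.symm))

/-- Boundary points that are close in the plane are close along the boundary. -/
theorem IsArclengthBoundary.exists_near {Ω : Set ℂ} {L : ℝ} {γ : ℝ → ℂ}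
    (hb : IsArclengthBoundary Ω L γ) {s : ℝ} (hs : s ∈ Ico 0 L) {ε : ℝ} (hε : 0 < ε) :
    ∃ ρ > 0, ∀ u, ‖γ u - γ s‖ < ρ → ∃ u', |u' - s| < ε ∧ γ u' = γ u := by
  -- This is the arc at parameter distance at least ε from s modulo L. It is compact and misses γ(s)
  -- by injectivity.
  have hK : IsClosed (γ '' Icc (s + ε) (s + L - ε)) :=
    (isCompact_Icc.image hb.continuous).isClosed
  have hnot : γ s ∉ γ '' Icc (s + ε) (s + L - ε) := by
    rintro ⟨u, hu, he⟩
    obtain ⟨hs0, hsL⟩ := hs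
    rcases lt_or_ge u L with h | h
    · have := hb.injOn ⟨by linarith [hu.1], h⟩ ⟨hs0, hsL⟩ he
      linarith [hu.1]
    · rw [← hb.periodic.sub_eq u] at he
      have := hb.injOn ⟨by linarith, by linarith [hu.2]⟩ ⟨hs0, hsL⟩ he
      linarith [hu.2]
  obtain ⟨ρ, hρ, hball⟩ := Metric.mem_nhds_iff.1 (hK.isOpen_compl.mem_nhds hnot)
  refine ⟨ρ, hρ, fun u hu => ?_⟩
  obtain ⟨u', hu', he⟩ := hb.periodic.exists_mem_Ioc hb.pos u (s - ε)
  refine ⟨u', ?_, he.symm⟩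
  by_contra hcon
  have h1 : s + ε ≤ u' := by
    by_contra h
    exact hcon (abs_lt.2 ⟨by linarith [hu'.1], by linarith⟩)
  refine hball (show γ u ∈ Metric.ball (γ s) ρ by rwa [mem_ball_iff_norm]) ?_
  exact ⟨u', ⟨h1, by linarith [hu'.2]⟩, he.symm⟩

/-- Near a point with a tangent, the boundary avoids the vectors that are transversal to it. -/
theorem IsArclengthBoundary.eventually_notMem_frontier {Ω : Set ℂ} {L : ℝ} {γ : ℝ → ℂ}
    (hb : IsArclengthBoundary Ω L γ) {s : ℝ} (hs : s ∈ Ico 0 L) (hd : DifferentiableAt ℝ γ s)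
    {m M : ℝ} (hm : 0 < m) (hM : 0 < M) :
    ∀ᶠ r : ℝ in 𝓝[>] 0, ∀ w : ℂ, m ≤ |(w * conj (deriv γ s)).im| → ‖w‖ ≤ M →
      γ s + r * w ∉ frontier Ω := by
  have n1 := hb.norm_deriv hs hd
  -- The bound η ≤ 1/2 absorbs the linearization error and yields |u' - s| ≤ 2rM; the bound 2ηM < m
  -- then contradicts a normal component of size at least rm.
  obtain ⟨η, hη0, hη⟩ : ∃ η > 0, η ≤ 1 / 2 ∧ η * (2 * M) < m := by
    refine ⟨min (1 / 2) (m / (4 * M)), by positivity, min_le_left _ _, ?_⟩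
    calc min (1 / 2) (m / (4 * M)) * (2 * M) ≤ m / (4 * M) * (2 * M) := by
          gcongr; exact min_le_right _ _
      _ = m / 2 := by field_simp; norm_num
      _ < m := by linarith
  obtain ⟨ε, hε, hlin⟩ := Metric.eventually_nhds_iff.1
    ((hasDerivAt_iff_isLittleO.1 hd.hasDerivAt).def hη0)
  obtain ⟨ρ, hρ, hnear⟩ := hb.exists_near hs hε
  have hsmall : ∀ᶠ r : ℝ in 𝓝[>] 0, r * M < ρ := by
    have : Tendsto (fun r : ℝ => r * M) (𝓝[>] 0) (𝓝 0) := by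
      have h : Tendsto (fun r : ℝ => r * M) (𝓝 0) (𝓝 (0 * M)) := tendsto_id.mul_const M
      rw [zero_mul] at h
      exact h.mono_left nhdsWithin_le_nhds
    exact this.eventually (gt_mem_nhds hρ)
  filter_upwards [hsmall, self_mem_nhdsWithin] with r hr hr0 w hmw hwM hfr
  have hr0' : 0 < r := hr0
  rw [← hb.range_eq] at hfr
  obtain ⟨u, hu⟩ := hfr
  have hrw : ‖(r : ℂ) * w‖ ≤ r * M := by
    rw [norm_mul, Complex.norm_real, Real.norm_of_nonneg hr0'.le]
    gcongr
  obtain ⟨u', hu', he⟩ := hnear u (by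
    rw [hu, add_sub_cancel_left]; exact hrw.trans_lt hr)
  have h1 := hlin (show dist u' s < ε from hu')
  have hγ : γ u' - γ s = r * w := by rw [he, hu]; ring
  rw [hγ, Real.norm_eq_abs] at h1
  set e : ℂ := (r : ℂ) * w - (u' - s) • deriv γ s with hedef
  have h2 : |u' - s| ≤ 2 * (r * M) := by
    have h3 : ‖(u' - s) • deriv γ s‖ = |u' - s| := by rw [norm_smul, n1, mul_one, Real.norm_eq_abs]
    have h4 : (u' - s) • deriv γ s = r * w - e := by rw [hedef]; ring
    have h5 : |u' - s| ≤ r * M + η * |u' - s| := by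
      rw [← h3, h4]
      refine (norm_sub_le _ _).trans (add_le_add hrw ?_)
      rw [← h4, h3]; exact h1
    nlinarith [abs_nonneg (u' - s)]
  -- A real multiple of the tangent has no normal component, so only the error e contributes.
  have h6 : ((r : ℂ) * w * conj (deriv γ s)).im = (e * conj (deriv γ s)).im := by
    have : (r : ℂ) * w * conj (deriv γ s) = e * conj (deriv γ s) + ((u' - s : ℝ) : ℂ) := by
      rw [hedef, Complex.real_smul]
      linear_combination ((u' - s : ℝ) : ℂ) * mul_conj_of_norm_eq_one n1
    rw [this, Complex.add_im, Complex.ofReal_im, add_zero]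
  have h7 : r * m ≤ η * |u' - s| := by
    calc r * m ≤ r * |(w * conj (deriv γ s)).im| := by gcongr
      _ = |((r : ℂ) * w * conj (deriv γ s)).im| := by
          rw [mul_assoc, Complex.im_ofReal_mul, abs_mul, abs_of_pos hr0']
      _ = |(e * conj (deriv γ s)).im| := by rw [h6]
      _ ≤ ‖e * conj (deriv γ s)‖ := Complex.abs_im_le_norm _
      _ = ‖e‖ := by rw [norm_mul, Complex.norm_conj, n1, mul_one]
      _ ≤ _ := h1
  nlinarith [mul_le_mul_of_nonneg_left h2 hη0.le, mul_lt_mul_of_pos_left hη.2 hr0']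

/-- The segment is connected and covered by the disjoint open sets Ω and the complement of its
closure. -/
theorem mem_of_segment_disjoint_frontier {Ω : Set ℂ} (hΩ : IsOpen Ω) {x y : ℂ} (hx : x ∈ Ω)
    (h : ∀ w ∈ segment ℝ x y, w ∉ frontier Ω) : y ∈ Ω := by
  refine (convex_segment x y).isPreconnected.subset_left_of_subset_union hΩ
    isClosed_closure.isOpen_compl (disjoint_compl_right_iff_subset.2 subset_closure)
    (fun w hw => ?_) ⟨x, left_mem_segment ℝ x y, hx⟩ (right_mem_segment ℝ x y)
  by_contra hcon
  rw [mem_union, not_or, mem_compl_iff, not_not] at hcon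
  exact h w hw (hΩ.frontier_eq ▸ ⟨hcon.2, hcon.1⟩)

theorem add_mul_mem_segment {c n v w : ℂ} {r : ℝ} (h : w ∈ segment ℝ (c + r * n) (c + r * v)) :
    ∃ w' ∈ segment ℝ n v, w = c + r * w' := by
  obtain ⟨a, b, ha, hb, hab, rfl⟩ := h
  refine ⟨a • n + b • v, ⟨a, b, ha, hb, hab, rfl⟩, ?_⟩
  simp only [Complex.real_smul]
  have : (a : ℂ) + b = 1 := by exact_mod_cast hab
  linear_combination c * this

/-- Convex combinations of two vectors on the same side of the tangent stay uniformly transversal to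
it. This carries the orientation hypothesis, which concerns the normal only, over to every
transversal direction. -/
theorem IsTable.eventually_segment_notMem_frontier {Ω : Set ℂ} {L : ℝ} {γ : ℝ → ℂ}
    (hT : IsTable Ω L γ) {s : ℝ} (hs : s ∈ Ico 0 L) (hd : DifferentiableAt ℝ γ s) {n v : ℂ}
    (h : 0 < (n * conj (deriv γ s)).im ∧ 0 < (v * conj (deriv γ s)).im ∨
      (n * conj (deriv γ s)).im < 0 ∧ (v * conj (deriv γ s)).im < 0) :
    ∀ᶠ r : ℝ in 𝓝[>] 0, ∀ w ∈ segment ℝ (γ s + r * n) (γ s + r * v), w ∉ frontier Ω := by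
  set m := min |(n * conj (deriv γ s)).im| |(v * conj (deriv γ s)).im|
  set M := max 1 (max ‖n‖ ‖v‖)
  have hm : 0 < m := by
    rcases h with ⟨h1, h2⟩ | ⟨h1, h2⟩
    · exact lt_min (abs_pos.2 h1.ne') (abs_pos.2 h2.ne')
    · exact lt_min (abs_pos.2 h1.ne) (abs_pos.2 h2.ne)
  have hM : 0 < M := lt_max_of_lt_left one_pos
  filter_upwards [hT.boundary.eventually_notMem_frontier hs hd hm hM] with r hr w hw
  obtain ⟨w', hw', rfl⟩ := add_mul_mem_segment hw
  obtain ⟨a, b, ha, hb, hab, rfl⟩ := hw'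
  apply hr
  · have him : ((a • n + b • v) * conj (deriv γ s)).im =
        a * (n * conj (deriv γ s)).im + b * (v * conj (deriv γ s)).im := by
      rw [add_mul, Complex.add_im, Complex.real_smul, Complex.real_smul, mul_assoc, mul_assoc,
        Complex.im_ofReal_mul, Complex.im_ofReal_mul]
    have hmn : m ≤ |(n * conj (deriv γ s)).im| := min_le_left _ _
    have hmv : m ≤ |(v * conj (deriv γ s)).im| := min_le_right _ _
    have hmm : m = a * m + b * m := by rw [← add_mul, hab, one_mul]
    rw [him]
    rcases h with ⟨h1, h2⟩ | ⟨h1, h2⟩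
    · rw [abs_of_pos h1] at hmn
      rw [abs_of_pos h2] at hmv
      refine le_trans ?_ (le_abs_self _)
      rw [hmm]; gcongr
    · rw [abs_of_neg h1] at hmn
      rw [abs_of_neg h2] at hmv
      refine le_trans ?_ (neg_le_abs _)
      rw [hmm]
      linarith [mul_le_mul_of_nonneg_left hmn ha, mul_le_mul_of_nonneg_left hmv hb]
  · calc ‖a • n + b • v‖ ≤ ‖a • n‖ + ‖b • v‖ := norm_add_le _ _
      _ = a * ‖n‖ + b * ‖v‖ := by
          rw [norm_smul, norm_smul, Real.norm_of_nonneg ha, Real.norm_of_nonneg hb]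
      _ ≤ a * M + b * M := by
          gcongr
          · exact (le_max_left _ _).trans (le_max_right _ _)
          · exact (le_max_right _ _).trans (le_max_right _ _)
      _ = M := by rw [← add_mul, hab, one_mul]

theorem IsArclengthBoundary.im_normal_mul_conj {Ω : Set ℂ} {L : ℝ} {γ : ℝ → ℂ}
    (hb : IsArclengthBoundary Ω L γ) {s : ℝ} (hs : s ∈ Ico 0 L) (hd : DifferentiableAt ℝ γ s) :
    (Complex.I * deriv γ s * conj (deriv γ s)).im = 1 := by
  rw [mul_assoc, mul_conj_of_norm_eq_one (hb.norm_deriv hs hd), mul_one, Complex.I_im]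

/-- The vectors on the left of the tangent point into `Ω`. -/
theorem IsTable.eventually_mem {Ω : Set ℂ} {L : ℝ} {γ : ℝ → ℂ} (hT : IsTable Ω L γ) {s : ℝ}
    (hs : s ∈ Ico 0 L) (hd : DifferentiableAt ℝ γ s) {v : ℂ}
    (hv : 0 < (v * conj (deriv γ s)).im) : ∀ᶠ r : ℝ in 𝓝[>] 0, γ s + r * v ∈ Ω := by
  have hn := hT.boundary.im_normal_mul_conj hs hd
  filter_upwards [hT.boundary.oriented s hd, hT.eventually_segment_notMem_frontier hs hd
    (n := Complex.I * deriv γ s) (v := v) (Or.inl ⟨by rw [hn]; exact one_pos, hv⟩)] with r h1 h2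
  exact mem_of_segment_disjoint_frontier hT.isOpen h1.1 h2

/-- The vectors on the right of the tangent point out of `Ω`. -/
theorem IsTable.eventually_notMem {Ω : Set ℂ} {L : ℝ} {γ : ℝ → ℂ} (hT : IsTable Ω L γ) {s : ℝ}
    (hs : s ∈ Ico 0 L) (hd : DifferentiableAt ℝ γ s) {v : ℂ}
    (hv : (v * conj (deriv γ s)).im < 0) : ∀ᶠ r : ℝ in 𝓝[>] 0, γ s + r * v ∉ Ω := by
  have hn := hT.boundary.im_normal_mul_conj hs hd
  filter_upwards [hT.boundary.oriented s hd, hT.eventually_segment_notMem_frontier hs hd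
    (n := v) (v := -(Complex.I * deriv γ s)) (Or.inr ⟨hv, by
      rw [neg_mul, Complex.neg_im, hn]; norm_num⟩)] with r h1 h2 h3
  refine h1.2 (subset_closure ?_)
  rw [sub_eq_add_neg, ← mul_neg]
  exact mem_of_segment_disjoint_frontier hT.isOpen h3 h2

/-- A ray that starts inside `Ω` hits the boundary. -/
theorem IsTable.exists_first_hit {Ω : Set ℂ} {L : ℝ} {γ : ℝ → ℂ} (hT : IsTable Ω L γ) {x v : ℂ}
    (hv : ‖v‖ = 1) (h : ∀ᶠ r : ℝ in 𝓝[>] 0, x + r * v ∈ Ω) :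
    ∃ t : ℝ, 0 < t ∧ (∃ s' ∈ Ico 0 L, γ s' = x + t * v) ∧ ∀ r ∈ Ioo 0 t, x + (r : ℂ) * v ∈ Ω := by
  obtain ⟨r₀, hr₀, hin⟩ := mem_nhdsGT_iff_exists_Ioo_subset.1 h
  have hr₀' : (0 : ℝ) < r₀ := hr₀
  have hcont : Continuous fun r : ℝ => x + (r : ℂ) * v := by fun_prop
  -- Starting at r₀/2 rather than 0 excludes the starting point, which may lie outside Ω, and makes
  -- the infimum positive; the ray is in Ω before r₀ anyway.
  set S : Set ℝ := Ici (r₀ / 2) ∩ (fun r : ℝ => x + (r : ℂ) * v) ⁻¹' Ωᶜ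
  have hS : IsClosed S := isClosed_Ici.inter (hT.isOpen.isClosed_compl.preimage hcont)
  have hSne : S.Nonempty := by
    obtain ⟨R, hR⟩ := hT.isBounded.exists_norm_le
    refine ⟨max (r₀ / 2) (R + ‖x‖ + 1), mem_Ici.2 (le_max_left _ _), fun hmem => ?_⟩
    have h1 := hR _ hmem
    set q := max (r₀ / 2) (R + ‖x‖ + 1)
    have h2 : R + ‖x‖ + 1 ≤ q := le_max_right _ _
    have h3 : ‖(q : ℂ) * v‖ = q := by
      rw [norm_mul, hv, mul_one, Complex.norm_real, Real.norm_of_nonneg]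
      exact le_max_of_le_left (by positivity)
    have h4 : ‖(q : ℂ) * v‖ ≤ ‖x + q * v‖ + ‖x‖ := by
      simpa using norm_sub_le (x + (q : ℂ) * v) x
    linarith
  have hbdd : BddBelow S := ⟨r₀ / 2, fun r hr => hr.1⟩
  have hmem := hS.csInf_mem hSne hbdd
  set t := sInf S
  have ht : 0 < t := lt_of_lt_of_le (by positivity : 0 < r₀ / 2) hmem.1
  have hbefore : ∀ r ∈ Ioo 0 t, x + (r : ℂ) * v ∈ Ω := by
    intro r hr
    rcases lt_or_ge r r₀ with h1 | h1
    · exact hin ⟨hr.1, h1⟩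
    · by_contra hcon
      exact absurd (csInf_le hbdd (show r ∈ S from ⟨show r₀ / 2 ≤ r by linarith, hcon⟩))
        (not_le.2 hr.2)
  have hcl : x + (t : ℂ) * v ∈ closure Ω := by
    have htend : Tendsto (fun r : ℝ => x + (r : ℂ) * v) (𝓝[<] t) (𝓝 (x + (t : ℂ) * v)) :=
      hcont.continuousAt.tendsto.mono_left nhdsWithin_le_nhds
    refine mem_closure_of_tendsto htend ?_
    filter_upwards [Ioo_mem_nhdsLT ht] with r hr using hbefore r hr
  have hfr : x + (t : ℂ) * v ∈ range γ := by
    rw [hT.boundary.range_eq, hT.isOpen.frontier_eq]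
    exact ⟨hcl, hmem.2⟩
  obtain ⟨u, hu⟩ := hfr
  obtain ⟨s', hs', he⟩ := hT.boundary.periodic.exists_mem_Ico₀ hT.boundary.pos u
  exact ⟨t, ht, ⟨s', hs', by rw [← he, hu]⟩, hbefore⟩

/-- The easy case of Sard's theorem: the derivative of the angle vanishes exactly where the chord
arrives tangentially, and one derivative suffices between spaces of equal dimension. -/
theorem volume_image_chordAngle_critical {γ : ℝ → ℂ} {s : ℝ} (hs : ‖deriv γ s‖ = 1) :
    volume (chordAngle γ s '' {s' | DifferentiableAt ℝ γ s' ∧ 0 < (chordVector γ s s').im ∧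
      (chordVector γ s' s).im = 0}) = 0 := by
  refine addHaar_image_eq_zero_of_det_fderivWithin_eq_zero volume (fun s' hs' =>
    (hasDerivAt_chordAngle hs hs'.1 hs'.2.1).hasFDerivAt.hasFDerivWithinAt) fun s' hs' => ?_
  rw [hs'.2.2, zero_div]
  simp

/-- From a footpoint with a tangent, almost every direction is regular. -/
theorem volume_slice_compl_regularSet {Ω : Set ℂ} {L : ℝ} {γ : ℝ → ℂ} (hT : IsTable Ω L γ)
    {s : ℝ} (hs : s ∈ Ico 0 L) (hd : DifferentiableAt ℝ γ s) :
    volume {θ | θ ∈ Icc 0 Real.pi ∧ (s, θ) ∉ regularSet Ω L γ} = 0 := by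
  have n1 := hT.boundary.norm_deriv hs hd
  obtain ⟨F, hF, hFd⟩ := hT.boundary.exists_finite_differentiableAt
  refine measure_mono_null (t := ({0, Real.pi} ∪ chordAngle γ s '' F) ∪
    chordAngle γ s '' {s' | DifferentiableAt ℝ γ s' ∧ 0 < (chordVector γ s s').im ∧
      (chordVector γ s' s).im = 0}) ?_ (measure_union_null
    (((toFinite {0, Real.pi}).union (hF.image _)).measure_zero _)
    (volume_image_chordAngle_critical n1))
  rintro θ ⟨hθ, hreg⟩
  by_cases h0 : θ = 0
  · exact Or.inl (Or.inl (Or.inl h0))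
  by_cases hpi : θ = Real.pi
  · exact Or.inl (Or.inl (Or.inr hpi))
  have hθ' : θ ∈ Ioo 0 Real.pi := ⟨hθ.1.lt_of_ne (Ne.symm h0), hθ.2.lt_of_ne hpi⟩
  have hv : ‖direction γ (s, θ)‖ = 1 := by
    rw [direction, norm_mul, n1, Complex.norm_exp_ofReal_mul_I, one_mul]
  have hvim : 0 < (direction γ (s, θ) * conj (deriv γ s)).im := by
    have : direction γ (s, θ) * conj (deriv γ s) = ((1 : ℝ) : ℂ) * Complex.exp (θ * Complex.I) := by
      rw [direction, Complex.ofReal_one]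
      linear_combination Complex.exp (θ * Complex.I) * mul_conj_of_norm_eq_one n1
    rw [this]
    exact im_mul_exp_mul_I_pos one_pos hθ'
  obtain ⟨t, ht, ⟨s', hs', e⟩, hin⟩ := hT.exists_first_hit hv (hT.eventually_mem hs hd hvim)
  have c1 := chordVector_eq_of_eq_add n1 e
  have hangle : chordAngle γ s s' = θ := by rw [chordAngle, c1, arg_mul_exp_mul_I ht hθ']
  have i1 : 0 < (chordVector γ s s').im := by rw [c1]; exact im_mul_exp_mul_I_pos ht hθ'
  by_cases hs'F : s' ∈ F
  · exact Or.inl (Or.inr ⟨s', hs'F, hangle⟩)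
  have hd' := hFd s' hs' hs'F
  have hseg : ∀ r ∈ Ioo (0 : ℝ) 1, γ s + (r : ℂ) * (γ s' - γ s) ∈ Ω := by
    intro r hr
    have := hin (r * t) ⟨mul_pos hr.1 ht, by nlinarith [hr.2]⟩
    rw [e, add_sub_cancel_left, ← mul_assoc]
    exact_mod_cast this
  rcases lt_trichotomy (chordVector γ s' s).im 0 with h | h | h
  -- A negative sign means that the chord reaches s' from the right of the tangent, where points
  -- near s' are outside Ω.
  · exfalso
    obtain ⟨r, hr, hr'⟩ := ((hT.eventually_notMem hs' hd' (v := γ s - γ s') h).and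
      (Ioo_mem_nhdsGT (zero_lt_one' ℝ))).exists
    apply hr
    have := hseg (1 - r) ⟨by linarith [hr'.2], by linarith [hr'.1]⟩
    convert this using 1
    push_cast; ring
  · exact Or.inr ⟨s', ⟨hd', i1, h⟩, hangle⟩
  · refine absurd ?_ hreg
    rw [← image_chordPhase hT.boundary]
    exact ⟨(s, s'), ⟨hs, hs', hd, hd', i1, h, hseg⟩, by rw [chordPhase, hangle]⟩

theorem liouville_compl_regularSet {Ω : Set ℂ} {L : ℝ} {γ : ℝ → ℂ} (hT : IsTable Ω L γ) :
    liouville L (regularSet Ω L γ)ᶜ = 0 := by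
  have hR := measurableSet_regularSet hT
  rw [liouville_apply L hR.compl]
  apply setLIntegral_measure_zero
  obtain ⟨F, hF, hFd⟩ := hT.boundary.exists_finite_differentiableAt
  rw [Measure.volume_eq_prod, Measure.measure_prod_null (hR.compl.inter (measurableSet_phaseSpace L))]
  filter_upwards [measure_eq_zero_iff_ae_notMem.1 (hF.measure_zero volume)] with s hsF
  by_cases hs : s ∈ Ico 0 L
  · refine measure_mono_null (fun θ hθ => ?_)
      (volume_slice_compl_regularSet hT hs (hFd s hs hsF))
    exact ⟨hθ.2.2, hθ.1⟩
  · have : Prod.mk s ⁻¹' ((regularSet Ω L γ)ᶜ ∩ phaseSpace L) = ∅ := by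
      ext θ
      simp only [mem_preimage, mem_inter_iff, mem_empty_iff_false, iff_false]
      exact fun h => hs h.2.1
    simp [this]

/-! ### The footpoint gain: existence, measurability, invariance and bounds -/

theorem lintegral_sin_Icc : ∫⁻ θ in Icc 0 Real.pi, ENNReal.ofReal (Real.sin θ) = ENNReal.ofReal 2 := by
  rw [← ofReal_integral_eq_lintegral_ofReal
    (Real.continuous_sin.continuousOn.integrableOn_compact isCompact_Icc)
    ((ae_restrict_mem measurableSet_Icc).mono fun θ hθ => Real.sin_nonneg_of_mem_Icc hθ),
    integral_Icc_eq_integral_Ioc, ← intervalIntegral.integral_of_le Real.pi_pos.le, integral_sin]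
  norm_num

theorem liouville_phaseSpace (L : ℝ) :
    liouville L (phaseSpace L) = ENNReal.ofReal (2 * L) := by
  rw [liouville_apply L (measurableSet_phaseSpace L), inter_self, phaseSpace,
    Measure.volume_eq_prod, ← Measure.prod_restrict, lintegral_prod _ measurable_sin_snd.aemeasurable]
  simp only [lintegral_sin_Icc]
  rw [setLIntegral_const, Real.volume_Ico, sub_zero, ← ENNReal.ofReal_mul (by norm_num)]

theorem liouville_univ (L : ℝ) : liouville L univ = ENNReal.ofReal (2 * L) := by
  rw [← liouville_phaseSpace L, liouville_apply L MeasurableSet.univ,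
    liouville_apply L (measurableSet_phaseSpace L), univ_inter, inter_self]

theorem isFiniteMeasure_liouville (L : ℝ) : IsFiniteMeasure (liouville L) :=
  ⟨by rw [liouville_univ L]; exact ENNReal.ofReal_lt_top⟩

variable {Ω : Set ℂ} {L : ℝ} {γ : ℝ → ℂ}

theorem footpointIncrement_mem_Icc (hL : 0 < L) (z : ℝ × ℝ) :
    footpointIncrement Ω L γ z ∈ Icc 0 L := by
  by_cases hz : ∃ z', IsStep Ω L γ z z'
  · have h := hz.choose_spec
    have hm : billiardMap Ω L γ z = hz.choose := dif_pos hz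
    rw [footpointIncrement, hm, arcIncrement]
    obtain ⟨h1, h2⟩ := h.left_s
    obtain ⟨h3, h4⟩ := h.right_s
    split_ifs <;> constructor <;> linarith
  · have hm : billiardMap Ω L γ z = z := dif_neg hz
    rw [footpointIncrement, hm, arcIncrement, if_pos le_rfl, sub_self]
    exact ⟨le_rfl, hL.le⟩

theorem abs_footpointIncrement_le (hL : 0 < L) (z : ℝ × ℝ) : |footpointIncrement Ω L γ z| ≤ L := by
  obtain ⟨h1, h2⟩ := footpointIncrement_mem_Icc (Ω := Ω) (γ := γ) hL z
  rwa [abs_of_nonneg h1]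

theorem measurable_footpointIncrement (hT : IsTable Ω L γ) :
    Measurable (footpointIncrement Ω L γ) := by
  have h1 : Measurable fun z => (billiardMap Ω L γ z).1 := measurable_fst.comp (measurable_billiardMap hT)
  unfold footpointIncrement arcIncrement
  exact Measurable.ite (measurableSet_le measurable_fst h1) (h1.sub measurable_fst)
    ((h1.add_const L).sub measurable_fst)

theorem ae_hasFootpointGain (hT : IsTable Ω L γ) :
    ∀ᵐ z ∂(liouville L), ∃ u, HasFootpointGain Ω L γ z u := by
  have := isFiniteMeasure_liouville L
  have hnull := liouville_compl_regularSet hT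
  have hmp := measurePreserving_billiardMap hT hnull
  have horbit : ∀ᵐ z ∂(liouville L), ∀ k : ℕ, (billiardMap Ω L γ)^[k] z ∈ regularSet Ω L γ :=
    ae_all_iff.2 fun k => (hmp.iterate k).quasiMeasurePreserving.ae (mem_ae_iff.2 hnull)
  filter_upwards [horbit, ae_exists_tendsto_birkhoff hmp (measurable_footpointIncrement hT)
    (abs_footpointIncrement_le hT.boundary.pos)] with z hz hu
  exact hu.imp fun u hu => ⟨hz, hu⟩

theorem measurable_average_footpointIncrement (hT : IsTable Ω L γ) (n : ℕ) :
    Measurable fun z => (1 / (n : ℝ)) *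
      ∑ k ∈ Finset.range n, footpointIncrement Ω L γ ((billiardMap Ω L γ)^[k] z) :=
  (measurable_birkhoffSum (measurable_billiardMap hT) (measurable_footpointIncrement hT)
    n).const_mul _

theorem measurableSet_hasFootpointGain (hT : IsTable Ω L γ) :
    MeasurableSet {z | ∃ u, HasFootpointGain Ω L γ z u} := by
  have heq : {z | ∃ u, HasFootpointGain Ω L γ z u} =
      (⋂ k : ℕ, (billiardMap Ω L γ)^[k] ⁻¹' regularSet Ω L γ) ∩
      {z | ∃ u, Tendsto (fun n : ℕ => (1 / (n : ℝ)) *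
        ∑ k ∈ Finset.range n, footpointIncrement Ω L γ ((billiardMap Ω L γ)^[k] z)) atTop (𝓝 u)} := by
    ext z
    simp only [HasFootpointGain, exists_and_left, mem_inter_iff, mem_iInter, mem_preimage,
      mem_ofPred_eq]
  rw [heq]
  exact (MeasurableSet.iInter fun k => (measurable_billiardMap hT).iterate k
    (measurableSet_regularSet hT)).inter
    (measurableSet_exists_tendsto (measurable_average_footpointIncrement hT))

theorem footpointGain_of_not_exists {z : ℝ × ℝ} (h : ¬ ∃ u, HasFootpointGain Ω L γ z u) :
    footpointGain Ω L γ z = 0 := dif_neg h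

theorem measurable_footpointGain (hT : IsTable Ω L γ) : Measurable (footpointGain Ω L γ) := by
  -- Cutting the averages off outside the measurable domain of convergence makes them converge
  -- everywhere, to the extension by 0.
  refine measurable_of_tendsto_metrizable (fun n =>
    (measurable_average_footpointIncrement hT n).indicator (measurableSet_hasFootpointGain hT))
    (tendsto_pi_nhds.2 fun z => ?_)
  by_cases hz : ∃ u, HasFootpointGain Ω L γ z u
  · obtain ⟨u, hu⟩ := hz
    rw [hu.eq_footpointGain]
    have hz : z ∈ {z | ∃ u, HasFootpointGain Ω L γ z u} := ⟨u, hu⟩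
    simpa only [indicator_of_mem hz] using hu.2
  · rw [footpointGain_of_not_exists hz]
    have hz' : z ∉ {z | ∃ u, HasFootpointGain Ω L γ z u} := hz
    simpa only [indicator_of_notMem hz'] using tendsto_const_nhds

theorem hasFootpointGain_billiardMap_iff (hL : 0 < L) {z : ℝ × ℝ} (hz : z ∈ regularSet Ω L γ)
    {u : ℝ} : HasFootpointGain Ω L γ (billiardMap Ω L γ z) u ↔ HasFootpointGain Ω L γ z u := by
  have hlim := tendsto_average_sub_average_apply (T := billiardMap Ω L γ)
    (abs_footpointIncrement_le (Ω := Ω) (γ := γ) hL) z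
  -- The orbit of the image is the orbit of z without its first point, which is regular by
  -- assumption; the averages differ by a null sequence.
  refine and_congr ⟨fun h k => ?_, fun h k => h (k + 1)⟩ ⟨fun h => ?_, fun h => ?_⟩
  · cases k with
    | zero => exact hz
    | succ k => exact h k
  · have := h.sub hlim
    simpa [birkhoffSum] using this
  · have := h.add hlim
    simpa [birkhoffSum] using this

theorem exists_hasFootpointGain_billiardMap_iff (hL : 0 < L) {z : ℝ × ℝ}
    (hz : z ∈ regularSet Ω L γ) : (∃ u, HasFootpointGain Ω L γ (billiardMap Ω L γ z) u) ↔
      ∃ u, HasFootpointGain Ω L γ z u :=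
  exists_congr fun _ => hasFootpointGain_billiardMap_iff hL hz

theorem footpointGain_billiardMap (hL : 0 < L) {z : ℝ × ℝ} (hz : z ∈ regularSet Ω L γ) :
    footpointGain Ω L γ (billiardMap Ω L γ z) = footpointGain Ω L γ z := by
  by_cases h : ∃ u, HasFootpointGain Ω L γ z u
  · obtain ⟨u, hu⟩ := h
    rw [hu.eq_footpointGain, ((hasFootpointGain_billiardMap_iff hL hz).2 hu).eq_footpointGain]
  · rw [footpointGain_of_not_exists h, footpointGain_of_not_exists
      (mt (exists_hasFootpointGain_billiardMap_iff hL hz).1 h)]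

theorem HasFootpointGain.mem_Icc (hL : 0 < L) {z : ℝ × ℝ} {u : ℝ}
    (h : HasFootpointGain Ω L γ z u) : u ∈ Icc 0 L := by
  have hξ := footpointIncrement_mem_Icc (Ω := Ω) (γ := γ) hL
  refine isClosed_Icc.mem_of_tendsto h.2 (Eventually.of_forall fun n => ⟨?_, ?_⟩)
  · exact mul_nonneg (by positivity) (Finset.sum_nonneg fun k _ => (hξ _).1)
  · rcases n.eq_zero_or_pos with rfl | hn
    · simpa using hL.le
    have hn0 : (0 : ℝ) < n := by exact_mod_cast hn
    rw [one_div, inv_mul_le_iff₀ hn0]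
    calc _ ≤ ∑ k ∈ Finset.range n, L := Finset.sum_le_sum fun k _ => (hξ _).2
      _ = n * L := by simp

theorem footpointGain_mem_Icc (hL : 0 < L) (z : ℝ × ℝ) : footpointGain Ω L γ z ∈ Icc 0 L := by
  by_cases h : ∃ u, HasFootpointGain Ω L γ z u
  · obtain ⟨u, hu⟩ := h
    rw [hu.eq_footpointGain]
    exact hu.mem_Icc hL
  · rw [footpointGain_of_not_exists h]
    exact ⟨le_rfl, hL.le⟩

theorem integrable_footpointGain (hT : IsTable Ω L γ) :
    Integrable (footpointGain Ω L γ) (liouville L) := by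
  have := isFiniteMeasure_liouville L
  refine Integrable.of_bound (measurable_footpointGain hT).aestronglyMeasurable L
    (Eventually.of_forall fun z => ?_)
  obtain ⟨h1, h2⟩ := footpointGain_mem_Icc (Ω := Ω) (γ := γ) hT.boundary.pos z
  rwa [Real.norm_of_nonneg h1]

theorem average_footpointGain_mem_Icc (hT : IsTable Ω L γ) :
    (∫ z, footpointGain Ω L γ z ∂(liouville L)) / (liouville L).real (phaseSpace L) ∈ Icc 0 L := by
  have hL := hT.boundary.pos
  have := isFiniteMeasure_liouville L
  have hmem := footpointGain_mem_Icc (Ω := Ω) (γ := γ) hL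
  have hreal : (liouville L).real (phaseSpace L) = 2 * L := by
    rw [measureReal_def, liouville_phaseSpace L, ENNReal.toReal_ofReal (by positivity)]
  have hreal' : (liouville L).real univ = 2 * L := by
    rw [measureReal_def, liouville_univ L, ENNReal.toReal_ofReal (by positivity)]
  rw [hreal]
  refine ⟨div_nonneg (integral_nonneg fun z => (hmem z).1) (by positivity), ?_⟩
  rw [div_le_iff₀ (by positivity)]
  calc ∫ z, footpointGain Ω L γ z ∂(liouville L) ≤ ∫ _, L ∂(liouville L) :=
        integral_mono (integrable_footpointGain hT) (integrable_const L) fun z => (hmem z).2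
    _ = L * (2 * L) := by rw [integral_const, hreal', smul_eq_mul, mul_comm]

theorem exists_hasRotationNumber_iff {z : ℝ × ℝ} :
    (∃ r, HasRotationNumber Ω L γ z r) ↔ ∃ u, HasFootpointGain Ω L γ z u :=
  ⟨fun ⟨_, u, hu, _⟩ => ⟨u, hu⟩, fun ⟨u, hu⟩ => ⟨u / L, u, hu, rfl⟩⟩

end Billiard

end

theorem mainTheorem4 (Ω : Set ℂ) (L : ℝ) (γ : ℝ → ℂ) (hT : Billiard.IsTable Ω L γ) :
    Billiard.liouville L (Billiard.phaseSpace L) = ENNReal.ofReal (2 * L) ∧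
    -- the footpoint gain
    ((∀ᵐ z ∂(Billiard.liouville L), ∃ u, Billiard.HasFootpointGain Ω L γ z u) ∧
      MeasurableSet {z | ∃ u, Billiard.HasFootpointGain Ω L γ z u} ∧
      Measurable (Billiard.footpointGain Ω L γ) ∧
      (∀ z ∈ Billiard.regularSet Ω L γ,
        ((∃ u, Billiard.HasFootpointGain Ω L γ (Billiard.billiardMap Ω L γ z) u) ↔
          ∃ u, Billiard.HasFootpointGain Ω L γ z u) ∧
        Billiard.footpointGain Ω L γ (Billiard.billiardMap Ω L γ z) =
          Billiard.footpointGain Ω L γ z) ∧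
      (∀ z u, Billiard.HasFootpointGain Ω L γ z u → 0 ≤ u ∧ u ≤ L) ∧
      Integrable (Billiard.footpointGain Ω L γ) (Billiard.liouville L) ∧
      0 ≤ (∫ z, Billiard.footpointGain Ω L γ z ∂(Billiard.liouville L)) /
        (Billiard.liouville L).real (Billiard.phaseSpace L) ∧
      (∫ z, Billiard.footpointGain Ω L γ z ∂(Billiard.liouville L)) /
        (Billiard.liouville L).real (Billiard.phaseSpace L) ≤ L) ∧
    -- the rotation number
    ((∀ᵐ z ∂(Billiard.liouville L), ∃ r, Billiard.HasRotationNumber Ω L γ z r) ∧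
      MeasurableSet {z | ∃ r, Billiard.HasRotationNumber Ω L γ z r} ∧
      Measurable (Billiard.rotationNumber Ω L γ) ∧
      (∀ z ∈ Billiard.regularSet Ω L γ,
        ((∃ r, Billiard.HasRotationNumber Ω L γ (Billiard.billiardMap Ω L γ z) r) ↔
          ∃ r, Billiard.HasRotationNumber Ω L γ z r) ∧
        Billiard.rotationNumber Ω L γ (Billiard.billiardMap Ω L γ z) =
          Billiard.rotationNumber Ω L γ z) ∧
      (∀ z r, Billiard.HasRotationNumber Ω L γ z r → 0 ≤ r ∧ r ≤ 1) ∧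
      Integrable (Billiard.rotationNumber Ω L γ) (Billiard.liouville L) ∧
      0 ≤ (∫ z, Billiard.rotationNumber Ω L γ z ∂(Billiard.liouville L)) /
        (Billiard.liouville L).real (Billiard.phaseSpace L) ∧
      (∫ z, Billiard.rotationNumber Ω L γ z ∂(Billiard.liouville L)) /
        (Billiard.liouville L).real (Billiard.phaseSpace L) ≤ 1) := by
  have hL := hT.boundary.pos
  have hint : ∫ z, Billiard.rotationNumber Ω L γ z ∂(Billiard.liouville L) =
      (∫ z, Billiard.footpointGain Ω L γ z ∂(Billiard.liouville L)) / L :=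
    integral_div L _
  have havg := Billiard.average_footpointGain_mem_Icc hT
  refine ⟨Billiard.liouville_phaseSpace L,
    ⟨Billiard.ae_hasFootpointGain hT, Billiard.measurableSet_hasFootpointGain hT,
      Billiard.measurable_footpointGain hT,
      fun z hz => ⟨Billiard.exists_hasFootpointGain_billiardMap_iff hL hz,
        Billiard.footpointGain_billiardMap hL hz⟩,
      fun z u hu => hu.mem_Icc hL, Billiard.integrable_footpointGain hT, havg.1, havg.2⟩, ?_⟩
  simp only [Billiard.exists_hasRotationNumber_iff]
  refine ⟨Billiard.ae_hasFootpointGain hT, Billiard.measurableSet_hasFootpointGain hT,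
    (Billiard.measurable_footpointGain hT).div_const L,
    fun z hz => ⟨Billiard.exists_hasFootpointGain_billiardMap_iff hL hz,
      congrArg (· / L) (Billiard.footpointGain_billiardMap hL hz)⟩, ?_,
    (Billiard.integrable_footpointGain hT).div_const L, ?_, ?_⟩
  · rintro z _ ⟨u, hu, rfl⟩
    exact ⟨div_nonneg (hu.mem_Icc hL).1 hL.le, (div_le_one hL).2 (hu.mem_Icc hL).2⟩
  · rw [hint, div_right_comm]
    exact div_nonneg havg.1 hL.le
  · rw [hint, div_right_comm]
    exact (div_le_one hL).2 havg.2
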